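/- Let $r\ge 1$ and let $R$ be a root system of type $A_r$ in a real Euclidean space $(\mathfrak a,\langle\cdot,\cdot\rangle)$, with the inner product normalized by $|\alpha|^2=2$ for all $\alpha\in R$, so that $\alpha^\vee=\frac{2}{|\alpha|^2}\alpha=\alpha$. Let $R^+$ be a choice of positive roots, $W_0$ the Weyl group, $\ell$ the length function of $W_0$ with respect to the simple reflections, and $P^+$ the set of dominant weights, i.e. of those $\lambda\in\mathfrak a$ with $\langle\alpha^\vee,\lambda\rangle\in\mathbb Z_{\ge 0}$ for all $\alpha\in R^+$. Fix an integer $q\ge 2$ and put $$\pi(\lambda)=\prod_{\alpha\in R^+}\langle\alpha^\vee,\lambda\rangle,\qquad q_{t_\lambda}=q^{\sum_{\alpha\in R^+}\langle\lambda,\alpha\rangle},\qquad W_0(q^{-1})=\sum_{w\in W_0}q^{-\ell(w)},\qquad \mathbf c(z)=\prod_{\alpha\in R^+}\frac{1-q^{-1}e^{-\langle\alpha^\vee,z\rangle}}{1-e^{-\langle\alpha^\vee,z\rangle}}.$$ For $\lambda\in P^+$ let $P_\lambda$ be the symmetric Macdonald polynomial (Macdonald spherical function) on $\mathfrak a_{\mathbb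 C}=\mathfrak a+i\mathfrak a$, $$P_\lambda(z)=\frac{q_{t_\lambda}^{-1/2}}{W_0(q^{-1})}\sum_{w\in W_0}\mathbf c(w\cdot z)\,e^{\langle\lambda,w\cdot z\rangle},$$ extended by continuity to the points where a denominator vanishes, and let $F_0(\lambda)=P_\lambda(0)$. Then, for every $\lambda\in P^+$, the limit defining $F_0(\lambda)$ exists and is real, and the following hold. (1) There is a constant $C>0$ such that, for all $\lambda\in P^+$, $$\frac1C\;q_{t_\lambda}^{-1/2}\prod_{\alpha\in R^+}\bigl(1+\langle\alpha^\vee,\lambda\rangle\bigr)\;\le\;F_0(\lambda)\;\le\;C\;q_{t_\lambda}^{-1/2}\prod_{\alpha\in R^+}\bigl(1+\langle\alpha^\vee,\lambda\rangle\bigr).$$ (2) There is a constant $c>0$ such that $$\frac{F_0(\lambda)}{c\,\pi(\lambda)\,q_{t_\lambda}^{-1/2}}\longrightarrow 1$$ when $\lambda\in P^+$ and $\langle\alpha,\lambda\rangle\to+\infty$ for all $\alpha\in R^+$. -/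

import Mathlib

open scoped Topology

noncomputable section

namespace MacdonaldSpherical

/-- `R` is a root system of type `A_r` in the Euclidean space `V` and `b` is its base of simple
roots. The roots and the coroots both live in `V` and are paired by the inner product, the coroot
of `α` is `α^∨ = 2 α / |α|²`, the inner product is normalized by `|α|² = 2`, and the Dynkin diagram
is that of type `A_r`. -/
structure IsTypeA {ι V : Type*} [NormedAddCommGroup V] [InnerProductSpace ℝ V]
    (r : ℕ) (R : RootPairing ι ℝ V V) (b : R.Base) : Prop where
  pairing_eq_inner : ∀ x y : V, R.toLinearMap x y = inner ℝ x y
  coroot_eq : ∀ i, R.coroot i = (2 / ‖R.root i‖ ^ 2) • R.root i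
  norm_sq_root : ∀ i, ‖R.root i‖ ^ 2 = 2
  cartan : ∃ e : Fin r ≃ b.support, ∀ i j,
    R.pairing (e i) (e j) = (CartanMatrix.A r i j : ℝ)

/-- The Weyl group of a finite root system is finite, since it acts faithfully on the roots. -/
instance finite_weylGroup {ι V N : Type*} [Finite ι] [AddCommGroup V] [Module ℝ V]
    [AddCommGroup N] [Module ℝ N] (R : RootPairing ι ℝ V N) [R.IsRootSystem] :
    Finite R.weylGroup := by
  refine Finite.of_injective (fun w : R.weylGroup => R.weylGroupToPerm w) ?_
  intro v w h
  have key : ∀ x : V, v • x = w • x := by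
    intro x
    have hx : x ∈ Submodule.span ℝ (Set.range R.root) := by simp
    induction hx using Submodule.span_induction with
    | mem x hx =>
      obtain ⟨i, rfl⟩ := hx
      rw [R.weylGroup_apply_root, R.weylGroup_apply_root]
      exact congrArg (fun p : Equiv.Perm ι => R.root (p i)) h
    | zero => simp
    | add x y _ _ hx hy => rw [smul_add, smul_add, hx, hy]
    | smul a x _ hx => rw [smul_comm v a x, smul_comm w a x, hx]
  apply Subtype.ext
  apply RootPairing.Equiv.weightHom_injective R
  ext x
  exact key x

section

variable {ι V : Type*} [Fintype ι] [NormedAddCommGroup V] [InnerProductSpace ℝ V]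
  {R : RootPairing ι ℝ V V}

open Classical in
/-- (Indices of) the positive roots `R⁺`, i.e. the roots that are sums of simple roots. -/
def posRoots (b : R.Base) : Finset ι := {i | b.IsPos i}

/-- The dominant weights `P⁺`: the weights (vectors pairing integrally with all the coroots) that
lie in the closed positive Weyl chamber. -/
def dominantWeights (b : R.Base) : Set V :=
  {l | (∀ i, ∃ n : ℤ, inner ℝ (R.coroot i) l = n) ∧ ∀ i ∈ posRoots b, 0 ≤ inner ℝ (R.root i) l}

/-- `π(λ) = ∏_{α ∈ R⁺} ⟨α^∨, λ⟩`. -/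
def piFun (b : R.Base) (l : V) : ℝ := ∏ i ∈ posRoots b, inner ℝ (R.coroot i) l

/-- `q_{t_λ} = q ^ ∑_{α ∈ R⁺} ⟨λ, α⟩`. -/
def qTranslation (q : ℕ) (b : R.Base) (l : V) : ℝ :=
  (q : ℝ) ^ (∑ i ∈ posRoots b, inner ℝ l (R.root i))

/-- The length of `w ∈ W₀`: the least number of factors in an expression of `w` as a product of
simple reflections. -/
def weylLength (b : R.Base) (w : R.weylGroup) : ℕ :=
  sInf {n | ∃ s : List b.support,
    s.length = n ∧ (s.map fun i => RootPairing.weylGroup.ofIdx R (i : ι)).prod = w}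

open Classical in
/-- `W₀(q⁻¹) = ∑_{w ∈ W₀} q_w⁻¹`, where `q_w = q ^ ℓ(w)`. -/
def weylPoincare [R.IsRootSystem] (q : ℕ) (b : R.Base) : ℝ :=
  letI : Fintype R.weylGroup := Fintype.ofFinite _
  ∑ w : R.weylGroup, ((q : ℝ) ^ weylLength b w)⁻¹

/-- The pairing `⟨v, z⟩` of `v ∈ 𝔞` with `z = x + i y ∈ 𝔞_ℂ`. The complexification
`𝔞_ℂ = 𝔞 + i 𝔞` is realized as `V × V`, the pair `(x, y)` standing for `x + i y`; the Weyl group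
acts on it componentwise. -/
def cpair (v : V) (z : V × V) : ℂ :=
  (inner ℝ v z.1 : ℝ) + (inner ℝ v z.2 : ℝ) * Complex.I

/-- `𝐜(z) = ∏_{α ∈ R⁺} (1 - q⁻¹ e^{-⟨α^∨, z⟩}) / (1 - e^{-⟨α^∨, z⟩})`. -/
def cFun (q : ℕ) (b : R.Base) (z : V × V) : ℂ :=
  ∏ i ∈ posRoots b, (1 - (q : ℂ)⁻¹ * Complex.exp (-cpair (R.coroot i) z)) /
    (1 - Complex.exp (-cpair (R.coroot i) z))

variable (R) in
/-- The points `z ∈ 𝔞_ℂ` at which no denominator of `𝐜(w · z)`, `w ∈ W₀`, vanishes. -/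
def regularPoints : Set (V × V) :=
  {z | ∀ i, Complex.exp (-cpair (R.coroot i) z) ≠ 1}

open Classical in
/-- The expression
`q_{t_λ}^{-1/2} / W₀(q⁻¹) * ∑_{w ∈ W₀} 𝐜(w · z) e^{⟨λ, w · z⟩}`, meaningful at regular points. -/
def macdonaldSum [R.IsRootSystem] (q : ℕ) (b : R.Base) (l : V) (z : V × V) : ℂ :=
  letI : Fintype R.weylGroup := Fintype.ofFinite _
  ((qTranslation q b l ^ (-(1 / 2) : ℝ) / weylPoincare q b : ℝ) : ℂ) *
    ∑ w : R.weylGroup, cFun q b (w • z) * Complex.exp (cpair l (w • z))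

/-- The symmetric Macdonald polynomial `P_λ` on `𝔞_ℂ`: the continuous extension of `macdonaldSum`
from the regular points. -/
def macdonaldP [R.IsRootSystem] (q : ℕ) (b : R.Base) (l : V) : V × V → ℂ :=
  extendFrom (regularPoints R) (macdonaldSum q b l)

/-- `F₀(λ) = P_λ(0)`. -/
def F₀ [R.IsRootSystem] (q : ℕ) (b : R.Base) (l : V) : ℂ := macdonaldP q b l 0

/-- The filter describing `λ ∈ P⁺`, `⟨α, λ⟩ → +∞` for all `α ∈ R⁺`. -/
def awayFromWalls (b : R.Base) : Filter V :=
  (⨅ i ∈ posRoots b, Filter.comap (fun l : V => inner ℝ (R.root i) l) Filter.atTop) ⊓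
    Filter.principal (dominantWeights b)

end

end MacdonaldSpherical

end

/-!
In standard coordinates `ε_0, …, ε_r` on a root system of type `A_r` (`n = r + 1`, positive roots
`ε_i - ε_j` for `i < j`, Weyl group `S_n`), a dominant weight is `λ = ∑ m_i ε_i` for a decreasing
tuple `m` of natural numbers. With `t = q⁻¹` and `x_i = e^{⟨ε_i, z⟩}`, the function `P_λ` is, up to the
factor `q_{t_λ}^{-1/2} / W₀(q⁻¹)`, the unnormalized Hall–Littlewood polynomial
`∑_σ σ (x^m ∏_{i < j} (x_i - t x_j) / (x_i - x_j))` (`StdCoordinates.macdonaldSum_eq`). Everything is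
a question about its value at `x = (1, …, 1)`.

* Expanding the numerators writes this polynomial as a signed sum of quotients of alternants, and
  the specialization `x_i = s ^ i`, `s → 1`, identifies the value at `(1, …, 1)`, if it exists, with
  an explicit polynomial `valueAtOne t m` in `m`: a signed sum of shifted Weyl dimension
  polynomials. All its terms have a multiple of `∏_{i < j} (m_i - m_j)` as leading part, and the
  factors add up to a positive multiple of `(1 - t) ^ (n (n - 1) / 2)`. This gives the
  asymptotics away from the walls (`tendsto_valueAtOne_div`) and, term by term, the upper bound
  (`exists_upper_bound`).

* The terms of this sum have both signs, so that near the walls the lower bound needs another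
  argument, the branching rule (`exists_branching`): setting one variable equal to `1` expands the
  polynomial into the Hall–Littlewood polynomials in `n - 1` variables of the exponents `μ`
  interlacing with `m`, with coefficients between `(1 - t) ^ (n - 1)` and `(1 + t) ^ (n - 1)`. By
  homogeneity and induction, this also proves that the value at `(1, …, 1)` exists
  (`tendsto_hallLittlewood`). For `t = 0` the coefficients are all `1` and the value is given by
  Weyl's dimension formula; hence by induction the value for `t` is at least a constant times the
  one for `t = 0`, which is at least a constant times `∏_{i < j} (1 + m_i - m_j)`
  (`exists_lower_bound`).

The branching rule is proved by splitting the sum over permutations according to the position of the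
variable `1`. The variables before it contribute letters `U_i` (`letterBefore`), those after it
letters `V_i` (`letterAfter`), so that one has to symmetrize the sum of the words `U_0 ⋯ U_{k-1} V_k
⋯ V_{n-2}`. The sums `U_i + V_i` are polynomials with nonnegative coefficients, and inside the
symmetrizer a product `V_i U_{i+1}` may be replaced by the monomial `t (x_i x_{i+1}) ^ m_{i+1}`
(`symmetrize_adjacent`). A three-term recursion for the sum of words then turns it into a polynomial
(`symmetrize_wordSum`), whose coefficients are seen to be positive by a recursion on pairs without
subtractions (`patternPoly`).
-/

open scoped Topology

noncomputable section

namespace HallLittlewood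

/-! ### Hall–Littlewood symmetrization -/

section Symmetrization

variable {K : Type*} [Field K] {n : ℕ}

/-- The kernel `∏_{i < j} (x_i - t x_j) / (x_i - x_j)` of the Hall–Littlewood symmetrizer. -/
def kernel (t : K) (x : Fin n → K) : K :=
  ∏ i, ∏ j, if i < j then (x i - t * x j) / (x i - x j) else 1

/-- The Hall–Littlewood symmetrizer `F ↦ ∑_σ σ (F · kernel)`. -/
def symmetrize (t : K) (F : (Fin n → K) → K) (x : Fin n → K) : K :=
  ∑ σ : Equiv.Perm (Fin n), F (x ∘ σ) * kernel t (x ∘ σ)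

/-- The unnormalized Hall–Littlewood polynomial of exponent `m`, as a function of `x` at the points
with distinct coordinates. -/
def hallLittlewood (t : K) (m : Fin n → ℕ) : (Fin n → K) → K :=
  symmetrize t fun y => ∏ i, y i ^ m i

lemma symmetrize_sub (t : K) (F G : (Fin n → K) → K) (x : Fin n → K) :
    symmetrize t (fun y => F y - G y) x = symmetrize t F x - symmetrize t G x := by
  simp [symmetrize, sub_mul, Finset.sum_sub_distrib]

lemma symmetrize_sum {α : Type*} (t : K) (s : Finset α) (F : α → (Fin n → K) → K)
    (x : Fin n → K) :
    symmetrize t (fun y => ∑ a ∈ s, F a y) x = ∑ a ∈ s, symmetrize t (F a) x := by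
  simp only [symmetrize, Finset.sum_mul]
  exact Finset.sum_comm

lemma symmetrize_const_mul (t c : K) (F : (Fin n → K) → K) (x : Fin n → K) :
    symmetrize t (fun y => c * F y) x = c * symmetrize t F x := by
  simp [symmetrize, Finset.mul_sum, mul_assoc]

/-- Splitting the factor of an adjacent pair `(i, j)` off the kernel, what remains is invariant
under the transposition of `i` and `j`. -/
lemma exists_kernel_eq (t : K) (x : Fin n → K) {i j : Fin n} (hij : (i : ℕ) + 1 = j) :
    ∃ k, kernel t x = k * ((x i - t * x j) / (x i - x j)) ∧
      kernel t (x ∘ Equiv.swap i j) = k * ((x j - t * x i) / (x j - x i)) := by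
  classical
  set P : Finset (Fin n × Fin n) := {p | p.1 < p.2}
  have hk (y : Fin n → K) : kernel t y =
      (∏ p ∈ P.erase (i, j), (y p.1 - t * y p.2) / (y p.1 - y p.2)) *
        ((y i - t * y j) / (y i - y j)) := by
    have hlt : i < j := by rw [Fin.lt_def]; omega
    rw [Finset.prod_erase_mul P (fun p : Fin n × Fin n => (y p.1 - t * y p.2) / (y p.1 - y p.2))
      (by simp [P, hlt])]
    rw [kernel, Finset.prod_filter, ← Finset.univ_product_univ, Finset.prod_product]
  refine ⟨_, hk x, ?_⟩
  rw [hk]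
  simp only [Function.comp_apply, Equiv.swap_apply_left, Equiv.swap_apply_right]
  congr 1
  refine Finset.prod_nbij' (fun p => (Equiv.swap i j p.1, Equiv.swap i j p.2))
    (fun p => (Equiv.swap i j p.1, Equiv.swap i j p.2)) ?_ ?_ ?_ ?_ ?_
  · rintro ⟨a, b⟩ h
    simp only [P, Finset.mem_erase, Finset.mem_filter, Finset.mem_univ, true_and, ne_eq,
      Prod.mk.injEq, Fin.lt_def, Equiv.swap_apply_def, Fin.ext_iff] at h ⊢
    split_ifs <;> omega
  · rintro ⟨a, b⟩ h
    simp only [P, Finset.mem_erase, Finset.mem_filter, Finset.mem_univ, true_and, ne_eq,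
      Prod.mk.injEq, Fin.lt_def, Equiv.swap_apply_def, Fin.ext_iff] at h ⊢
    split_ifs <;> omega
  · simp
  · simp
  · simp

variable [CharZero K]

/-- Two functions have the same symmetrization as soon as, after multiplication by the kernel, the
sums of their values at `y` and at `y ∘ s` agree, for a fixed permutation `s`. -/
lemma symmetrize_congr_of_perm (t : K) {F F' : (Fin n → K) → K} {x : Fin n → K}
    (s : Equiv.Perm (Fin n))
    (h : ∀ σ : Equiv.Perm (Fin n),
      F (x ∘ σ) * kernel t (x ∘ σ) + F ((x ∘ σ) ∘ s) * kernel t ((x ∘ σ) ∘ s) =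
      F' (x ∘ σ) * kernel t (x ∘ σ) + F' ((x ∘ σ) ∘ s) * kernel t ((x ∘ σ) ∘ s)) :
    symmetrize t F x = symmetrize t F' x := by
  have key (G : (Fin n → K) → K) : 2 * symmetrize t G x = ∑ σ : Equiv.Perm (Fin n),
      (G (x ∘ σ) * kernel t (x ∘ σ) + G ((x ∘ σ) ∘ s) * kernel t ((x ∘ σ) ∘ s)) := by
    rw [two_mul, Finset.sum_add_distrib]
    congr 1
    rw [symmetrize, ← Equiv.sum_comp (Equiv.mulRight s)]
    rfl
  have h2 : (2 : K) ≠ 0 := two_ne_zero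
  apply mul_left_cancel₀ h2
  rw [key, key]
  exact Finset.sum_congr rfl fun σ _ => h σ

/-- Inside the symmetrizer the product `V(x_i) U(x_j)` of an adjacent pair collapses to the monomial
`t (x_i x_j) ^ c`. -/
lemma symmetrize_adjacent (t : K) {G : (Fin n → K) → K} {x : Fin n → K}
    (hx : Function.Injective x) (hx1 : ∀ i, x i ≠ 1) {i j : Fin n} (hij : (i : ℕ) + 1 = j)
    (c : ℕ) (hG : ∀ y, G (y ∘ Equiv.swap i j) = G y) :
    symmetrize t (fun y => G y * ((y i ^ c * ((1 - t * y i) / (1 - y i))) *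
      (y j ^ c * ((y j - t) / (y j - 1))))) x =
    symmetrize t (fun y => G y * (t * (y i ^ c * y j ^ c))) x := by
  refine symmetrize_congr_of_perm t (Equiv.swap i j) fun σ => ?_
  obtain ⟨k, h1, h2⟩ := exists_kernel_eq t (x ∘ σ) hij
  rw [h1, h2, hG]
  simp only [Function.comp_apply, Equiv.swap_apply_left, Equiv.swap_apply_right]
  have hne : x (σ i) ≠ x (σ j) := fun h => by
    have := σ.injective (hx h)
    subst this; omega
  have ha := hx1 (σ i)
  have hb := hx1 (σ j)
  generalize x (σ i) = a at *
  generalize x (σ j) = b at *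
  have e1 : a - b ≠ 0 := sub_ne_zero.2 hne
  have e2 : b - a ≠ 0 := sub_ne_zero.2 hne.symm
  have e3 : 1 - a ≠ 0 := sub_ne_zero.2 ha.symm
  have e4 : 1 - b ≠ 0 := sub_ne_zero.2 hb.symm
  have e5 : b - 1 ≠ 0 := sub_ne_zero.2 hb
  have e6 : a - 1 ≠ 0 := sub_ne_zero.2 ha
  have key : ((1 - t * a) / (1 - a)) * ((b - t) / (b - 1)) * ((a - t * b) / (a - b)) +
      ((1 - t * b) / (1 - b)) * ((a - t) / (a - 1)) * ((b - t * a) / (b - a)) =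
      t * ((a - t * b) / (a - b)) + t * ((b - t * a) / (b - a)) := by
    rw [← neg_sub b 1, ← neg_sub a 1, ← neg_sub a b]
    field_simp
    ring
  linear_combination (G (x ∘ σ) * k * a ^ c * b ^ c) * key

end Symmetrization

/-! ### Words in two letters -/

section Words

variable {R : Type*} [CommRing R]

/-- The sum of the words `u_0 ⋯ u_{k-1} v_k ⋯ v_{j-1}`, `0 ≤ k ≤ j`. -/
def wordSum (u v : ℕ → R) (j : ℕ) : R :=
  ∑ k ∈ Finset.range (j + 1), (∏ i ∈ Finset.range k, u i) * ∏ i ∈ Finset.Ico k j, v i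

@[simp] lemma wordSum_zero (u v : ℕ → R) : wordSum u v 0 = 1 := by simp [wordSum]

lemma wordSum_succ (u v : ℕ → R) (j : ℕ) :
    wordSum u v (j + 1) = wordSum u v j * v j + ∏ i ∈ Finset.range (j + 1), u i := by
  rw [wordSum, Finset.sum_range_succ, wordSum, Finset.sum_mul]
  congr 1
  · refine Finset.sum_congr rfl fun k hk => ?_
    rw [Finset.prod_Ico_succ_top (by simpa [Nat.lt_succ_iff] using hk), mul_assoc]
  · simp

lemma wordSum_add_two (u v : ℕ → R) (j : ℕ) :
    wordSum u v (j + 2) =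
      wordSum u v (j + 1) * (u (j + 1) + v (j + 1)) - wordSum u v j * (v j * u (j + 1)) := by
  have h1 := wordSum_succ u v j
  have h2 := wordSum_succ u v (j + 1)
  rw [Finset.prod_range_succ] at h2
  rw [h2]
  linear_combination (-u (j + 1)) * h1

lemma wordSum_congr {u v u' v' : ℕ → R} {j : ℕ} (hu : ∀ i < j, u i = u' i)
    (hv : ∀ i < j, v i = v' i) : wordSum u v j = wordSum u' v' j := by
  refine Finset.sum_congr rfl fun k hk => ?_
  have hk' : k ≤ j := by simpa [Nat.lt_succ_iff] using hk
  congr 1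
  · exact Finset.prod_congr rfl fun i hi => hu i (by simp at hi; omega)
  · exact Finset.prod_congr rfl fun i hi => hv i (by simp at hi; omega)

end Words

/-! ### The branching rule -/

section Branching

variable {K : Type*} [Field K] {n : ℕ}

/-- A finite tuple as a sequence, extended by `0`. -/
def toSeq (x : Fin n → K) (i : ℕ) : K := if h : i < n then x ⟨i, h⟩ else 0

lemma toSeq_of_lt (x : Fin n → K) {i : ℕ} (h : i < n) : toSeq x i = x ⟨i, h⟩ := dif_pos h

lemma toSeq_comp_swap (x : Fin n → K) {i j : Fin n} {k : ℕ} (hi : k ≠ i) (hj : k ≠ j) :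
    toSeq (x ∘ Equiv.swap i j) k = toSeq x k := by
  unfold toSeq
  split_ifs with h
  · rw [Function.comp_apply, Equiv.swap_apply_of_ne_of_ne] <;> simpa [Fin.ext_iff]
  · rfl

/-- The letter contributed by a variable `y` placed before the distinguished variable `1`. -/
def letterBefore (t : K) (m : ℕ → ℕ) (y : ℕ → K) (i : ℕ) : K :=
  y i ^ m i * ((y i - t) / (y i - 1))

/-- The letter contributed by a variable `y` placed after the distinguished variable `1`. -/
def letterAfter (t : K) (m : ℕ → ℕ) (y : ℕ → K) (i : ℕ) : K :=
  y i ^ m (i + 1) * ((1 - t * y i) / (1 - y i))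

/-- The polynomial `(1 - t) ∑_{m_{i+1} < c ≤ m_i} y_i ^ c`. -/
def upperSum (t : K) (m : ℕ → ℕ) (y : ℕ → K) (i : ℕ) : K :=
  (1 - t) * ∑ c ∈ Finset.Ioc (m (i + 1)) (m i), y i ^ c

/-- The generating polynomial of the interlacing patterns, weighted with their branching
coefficients. The second component is what is left of the first one after subtracting
`y_{j-1} ^ m_j` times its predecessor; carrying it along makes the recursion free of
subtractions. -/
def patternPoly (t : K) (m : ℕ → ℕ) (y : ℕ → K) : ℕ → K × K
  | 0 => (1, 1)
  | j + 1 =>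
    ((patternPoly t m y j).1 * (y j ^ m (j + 1) + upperSum t m y j) +
        t * y j ^ m j * (patternPoly t m y j).2,
      (patternPoly t m y j).1 * upperSum t m y j + t * y j ^ m j * (patternPoly t m y j).2)

lemma patternPoly_add_two (t : K) (m : ℕ → ℕ) (y : ℕ → K) (j : ℕ) :
    (patternPoly t m y (j + 2)).1 =
      (patternPoly t m y (j + 1)).1 *
        (y (j + 1) ^ m (j + 2) + upperSum t m y (j + 1) + t * y (j + 1) ^ m (j + 1)) -
      (patternPoly t m y j).1 * (t * (y j ^ m (j + 1) * y (j + 1) ^ m (j + 1))) := by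
  simp only [patternPoly]
  ring

/-- The sum of the two letters is a polynomial. -/
lemma letterBefore_add_letterAfter (t : K) {m : ℕ → ℕ} (hm : Antitone m) {y : ℕ → K} {i : ℕ}
    (hy : y i ≠ 1) :
    letterBefore t m y i + letterAfter t m y i =
      y i ^ m (i + 1) + upperSum t m y i + t * y i ^ m i := by
  have h1 : y i - 1 ≠ 0 := sub_ne_zero.2 hy
  have h2 : 1 - y i ≠ 0 := sub_ne_zero.2 hy.symm
  have hab : m (i + 1) ≤ m i := hm i.le_succ
  unfold letterBefore letterAfter upperSum
  generalize m (i + 1) = b at *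
  generalize m i = a at *
  generalize y i = z at *
  have h3 : (1 - t * z) / (1 - z) = -((1 - t * z) / (z - 1)) := by
    rw [← neg_sub z 1, div_neg]
  rw [h3]
  induction a, hab using Nat.le_induction with
  | base => simp; field_simp; ring
  | succ a hab ih =>
    rw [Finset.sum_Ioc_succ_top hab, mul_add]
    have : z ^ (a + 1) * ((z - t) / (z - 1)) =
        z ^ a * ((z - t) / (z - 1)) + z ^ a * (z - t) := by
      field_simp; ring
    rw [this]
    linear_combination ih

variable [CharZero K]

/-- Inside the symmetrizer, the sum over the words of letters may be replaced by the generating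
polynomial of the interlacing patterns. -/
lemma symmetrize_wordSum (t : K) {m : ℕ → ℕ} (hm : Antitone m) {x : Fin n → K}
    (hx : Function.Injective x) (hx1 : ∀ i, x i ≠ 1) (j : ℕ) (hj : j ≤ n)
    (G : (Fin n → K) → K)
    (hG : ∀ a b : Fin n, (a : ℕ) + 1 = b → (b : ℕ) < j → ∀ y, G (y ∘ Equiv.swap a b) = G y) :
    symmetrize t (fun y =>
      wordSum (letterBefore t m (toSeq y)) (letterAfter t m (toSeq y)) j * G y) x =
    symmetrize t (fun y => (patternPoly t m (toSeq y) j).1 * G y) x := by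
  have hA (k : ℕ) (hk : k < n) (σ : Equiv.Perm (Fin n)) :=
    letterBefore_add_letterAfter t hm (y := toSeq (x ∘ σ)) (i := k)
      (by rw [toSeq_of_lt _ hk]; exact hx1 _)
  induction j using Nat.twoStepInduction generalizing G with
  | zero => simp [patternPoly]
  | one =>
    refine Finset.sum_congr rfl fun σ _ => ?_
    dsimp only
    rw [wordSum_succ]
    simp only [wordSum_zero, zero_add, Finset.range_one, Finset.prod_singleton, patternPoly,
      one_mul, mul_one]
    rw [add_comm (letterAfter _ _ _ _), hA 0 hj]
  | more j ih1 ih2 =>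
    -- the two neighbouring variables of the last two letters
    let a : Fin n := ⟨j, by omega⟩
    let b : Fin n := ⟨j + 1, by omega⟩
    have e1 : symmetrize t (fun y =>
        wordSum (letterBefore t m (toSeq y)) (letterAfter t m (toSeq y)) (j + 1) *
          ((letterBefore t m (toSeq y) (j + 1) + letterAfter t m (toSeq y) (j + 1)) * G y)) x =
        symmetrize t (fun y => (patternPoly t m (toSeq y) (j + 1)).1 *
          ((letterBefore t m (toSeq y) (j + 1) + letterAfter t m (toSeq y) (j + 1)) * G y)) x := by
      refine ih2 (by omega) _ fun c d hcd hd y => ?_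
      rw [hG c d hcd (by omega)]
      simp only [letterBefore, letterAfter]
      rw [toSeq_comp_swap y (by omega) (by omega)]
    have e2 : symmetrize t (fun y =>
        wordSum (letterBefore t m (toSeq y)) (letterAfter t m (toSeq y)) j * G y *
          (letterAfter t m (toSeq y) j * letterBefore t m (toSeq y) (j + 1))) x =
        symmetrize t (fun y =>
          wordSum (letterBefore t m (toSeq y)) (letterAfter t m (toSeq y)) j * G y *
          (t * (toSeq y j ^ m (j + 1) * toSeq y (j + 1) ^ m (j + 1)))) x := by
      have := symmetrize_adjacent t
        (G := fun y => wordSum (letterBefore t m (toSeq y)) (letterAfter t m (toSeq y)) j * G y)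
        hx hx1 (i := a) (j := b) rfl (m (j + 1)) (fun y => by
          rw [hG a b rfl (by simp [b])]
          congr 1
          refine wordSum_congr (fun i hi => ?_) fun i hi => ?_
          · simp only [letterBefore]
            rw [toSeq_comp_swap y (by simp [a]; omega) (by simp [b]; omega)]
          · simp only [letterAfter]
            rw [toSeq_comp_swap y (by simp [a]; omega) (by simp [b]; omega)])
      have ha (y : Fin n → K) : toSeq y j = y a := toSeq_of_lt y a.2
      have hb (y : Fin n → K) : toSeq y (j + 1) = y b := toSeq_of_lt y b.2
      simp only [letterAfter, letterBefore, ha, hb] at this ⊢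
      exact this
    have e3 := ih1 (by omega)
      (fun y => G y * (t * (toSeq y j ^ m (j + 1) * toSeq y (j + 1) ^ m (j + 1))))
      fun c d hcd hd y => by
        rw [hG c d hcd (by omega), toSeq_comp_swap y (by omega) (by omega),
          toSeq_comp_swap y (by omega) (by omega)]
    have e4 : symmetrize t (fun y => (patternPoly t m (toSeq y) (j + 1)).1 *
          ((letterBefore t m (toSeq y) (j + 1) + letterAfter t m (toSeq y) (j + 1)) * G y)) x =
        symmetrize t (fun y => (patternPoly t m (toSeq y) (j + 1)).1 *
          ((toSeq y (j + 1) ^ m (j + 2) + upperSum t m (toSeq y) (j + 1) +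
            t * toSeq y (j + 1) ^ m (j + 1)) * G y)) x := by
      refine Finset.sum_congr rfl fun σ _ => ?_
      dsimp only
      rw [hA (j + 1) (by omega)]
    calc _ = symmetrize t (fun y =>
        wordSum (letterBefore t m (toSeq y)) (letterAfter t m (toSeq y)) (j + 1) *
          ((letterBefore t m (toSeq y) (j + 1) + letterAfter t m (toSeq y) (j + 1)) * G y) -
        wordSum (letterBefore t m (toSeq y)) (letterAfter t m (toSeq y)) j * G y *
          (letterAfter t m (toSeq y) j * letterBefore t m (toSeq y) (j + 1))) x := by
          congr 1; funext y; rw [wordSum_add_two]; ring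
      _ = symmetrize t (fun y => (patternPoly t m (toSeq y) (j + 1)).1 *
          ((toSeq y (j + 1) ^ m (j + 2) + upperSum t m (toSeq y) (j + 1) +
            t * toSeq y (j + 1) ^ m (j + 1)) * G y) -
          (patternPoly t m (toSeq y) j).1 *
            (G y * (t * (toSeq y j ^ m (j + 1) * toSeq y (j + 1) ^ m (j + 1))))) x := by
          rw [symmetrize_sub, symmetrize_sub, e1, e4, e2, ← e3]
          simp only [mul_assoc]
      _ = _ := by congr 1; funext y; rw [patternPoly_add_two]; ring

/-- The permutation of `Fin (n + 1)` that puts `0` in position `k` and orders the remaining indices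
by a permutation of `Fin n`. -/
def insertPerm (k : Fin (n + 1)) (τ : Equiv.Perm (Fin n)) : Equiv.Perm (Fin (n + 1)) :=
  (finSuccEquiv' k).trans ((Equiv.optionCongr τ).trans (finSuccEquiv n).symm)

omit [Field K] [CharZero K] in
lemma cons_comp_insertPerm (y : K) (x : Fin n → K) (k : Fin (n + 1)) (τ : Equiv.Perm (Fin n)) :
    (Fin.cons y x : Fin (n + 1) → K) ∘ insertPerm k τ = k.insertNth y (x ∘ τ) := by
  funext i
  induction i using Fin.succAboveCases k with
  | x => simp [insertPerm]
  | p i => simp [insertPerm]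

lemma insertPerm_bijective :
    Function.Bijective fun p : Fin (n + 1) × Equiv.Perm (Fin n) => insertPerm p.1 p.2 := by
  rw [Fintype.bijective_iff_injective_and_card]
  constructor
  · rintro ⟨k, τ⟩ ⟨k', τ'⟩ h
    dsimp only at h
    have h0 : k = k' := by
      apply (insertPerm k' τ').injective
      rw [← h]
      have : insertPerm k τ k = 0 := by simp [insertPerm]
      rw [this, h]; simp [insertPerm]
    subst h0
    refine Prod.ext rfl (Equiv.ext fun i => ?_)
    simpa [insertPerm] using DFunLike.congr_fun h (k.succAbove i)
  · simp [Fintype.card_perm, Nat.factorial_succ]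

omit [CharZero K] in
lemma kernel_insertNth (t y : K) (x : Fin n → K) (k : Fin (n + 1)) :
    kernel t (k.insertNth y x : Fin (n + 1) → K) = kernel t x *
      ∏ i : Fin n, if i.castSucc < k then (x i - t * y) / (x i - y)
        else (y - t * x i) / (y - x i) := by
  unfold kernel
  rw [Fin.prod_univ_succAbove _ k]
  simp only [Fin.prod_univ_succAbove _ k, Fin.insertNth_apply_same, Fin.insertNth_apply_succAbove,
    Fin.succAbove_lt_succAbove_iff, lt_irrefl, if_false, one_mul, Finset.prod_mul_distrib,
    Fin.succAbove_lt_iff_castSucc_lt, Fin.lt_succAbove_iff_le_castSucc]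
  rw [← mul_assoc, mul_comm, ← Finset.prod_mul_distrib]
  congr 1
  refine Finset.prod_congr rfl fun i _ => ?_
  by_cases h : i.castSucc < k
  · simp [h, not_le.2 h]
  · simp [h, not_lt.1 h]

/-- Branching of Hall–Littlewood polynomials when one of the variables is set to `1`: splitting the
sum over the permutations according to the position of the variable `1` produces the words of
letters. -/
lemma hallLittlewood_cons_one (t : K) {m : ℕ → ℕ} (hm : Antitone m) {x : Fin n → K}
    (hx : Function.Injective x) (hx1 : ∀ i, x i ≠ 1) :
    hallLittlewood t (fun i : Fin (n + 1) => m i) (Fin.cons 1 x) =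
      symmetrize t (fun y => (patternPoly t m (toSeq y) n).1) x := by
  have h := symmetrize_wordSum t hm hx hx1 n le_rfl (fun _ => 1) (fun _ _ _ _ _ => rfl)
  simp only [mul_one] at h
  rw [← h, hallLittlewood, symmetrize, symmetrize]
  rw [← (Equiv.ofBijective _ (insertPerm_bijective (n := n))).sum_comp, Fintype.sum_prod_type,
    Finset.sum_comm]
  refine Finset.sum_congr rfl fun τ _ => ?_
  rw [wordSum, Finset.sum_mul, ← Fin.sum_univ_eq_sum_range
    (fun k => (∏ i ∈ Finset.range k, letterBefore t m (toSeq (x ∘ τ)) i) *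
      (∏ i ∈ Finset.Ico k n, letterAfter t m (toSeq (x ∘ τ)) i) * kernel t (x ∘ τ)) (n + 1)]
  refine Finset.sum_congr rfl fun k _ => ?_
  simp only [Equiv.ofBijective_apply, cons_comp_insertPerm, kernel_insertNth]
  generalize x ∘ τ = z
  have hword : (∏ i ∈ Finset.range k, letterBefore t m (toSeq z) i) *
      (∏ i ∈ Finset.Ico (k : ℕ) n, letterAfter t m (toSeq z) i) =
      ∏ i : Fin n, if (i : ℕ) < k then letterBefore t m (toSeq z) i
        else letterAfter t m (toSeq z) i := by
    rw [Fin.prod_univ_eq_prod_range (fun i => if i < (k : ℕ) then letterBefore t m (toSeq z) i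
        else letterAfter t m (toSeq z) i) n,
      ← Finset.prod_range_mul_prod_Ico _ (Nat.lt_succ_iff.1 k.2)]
    congr 1
    · exact Finset.prod_congr rfl fun i hi => by rw [if_pos (Finset.mem_range.1 hi)]
    · exact Finset.prod_congr rfl fun i hi => by
        rw [if_neg (not_lt.2 (Finset.mem_Ico.1 hi).1)]
  rw [hword, Fin.prod_univ_succAbove _ k]
  simp only [Fin.insertNth_apply_same, Fin.insertNth_apply_succAbove, one_pow, one_mul]
  rw [mul_comm (kernel t z), ← mul_assoc, ← Finset.prod_mul_distrib]
  congr 1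
  refine Finset.prod_congr rfl fun i _ => ?_
  simp only [letterBefore, letterAfter, toSeq_of_lt _ i.2, Fin.eta, Fin.lt_def, Fin.val_castSucc]
  by_cases h : (i : ℕ) < k
  · rw [Fin.succAbove_of_castSucc_lt _ _ (by simpa [Fin.lt_def] using h)]
    simp [h]
  · rw [Fin.succAbove_of_le_castSucc _ _ (by simpa [Fin.le_def] using h)]
    simp [h]

end Branching

variable {n : ℕ}

/-! ### Interlacing exponents -/

/-- The exponents `μ` interlacing with `m`, i.e. with `m_{i+1} ≤ μ_i ≤ m_i`. -/
def interlacing (m : Fin (n + 1) → ℕ) : Finset (Fin n → ℕ) :=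
  Fintype.piFinset fun i => Finset.Icc (m i.succ) (m i.castSucc)

lemma antitone_of_mem_interlacing {m : Fin (n + 1) → ℕ} (hm : Antitone m) {μ : Fin n → ℕ}
    (hμ : μ ∈ interlacing m) : Antitone μ := by
  simp only [interlacing, Fintype.mem_piFinset, Finset.mem_Icc] at hμ
  intro a b hab
  obtain rfl | hlt := hab.eq_or_lt
  · exact le_rfl
  · exact (hμ b).2.trans ((hm (by rw [Fin.le_def]; simpa using hlt)).trans (hμ a).1)

lemma sum_interlacing_succ {M : Type*} [AddCommMonoid M] (m : Fin (n + 2) → ℕ)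
    (F : (Fin n → ℕ) → ℕ → M) :
    ∑ μ ∈ interlacing m, F (Fin.init μ) (μ (Fin.last n)) =
      ∑ ν ∈ interlacing (Fin.init m : Fin (n + 1) → ℕ),
        ∑ c ∈ Finset.Icc (m (Fin.last (n + 1))) (m (Fin.last n).castSucc), F ν c := by
  rw [← Finset.sum_product']
  refine Finset.sum_nbij' (fun μ => (Fin.init μ, μ (Fin.last n)))
    (fun p => (Fin.snoc p.1 p.2 : Fin (n + 1) → ℕ)) ?_ ?_ ?_ ?_ ?_
  · intro μ hμ
    simp only [interlacing, Fintype.mem_piFinset, Finset.mem_Icc, Finset.mem_product] at hμ ⊢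
    exact ⟨fun i => hμ i.castSucc, hμ (Fin.last n)⟩
  · rintro ⟨ν, c⟩ h
    simp only [interlacing, Fintype.mem_piFinset, Finset.mem_Icc, Finset.mem_product] at h ⊢
    intro i
    induction i using Fin.lastCases with
    | last => simpa using h.2
    | cast i => simpa [Fin.init] using h.1 i
  · simp
  · simp
  · simp

lemma sum_Icc_ite {a b : ℕ} (hab : b ≤ a) (u v : ℂ) (y : ℂ) :
    ∑ c ∈ Finset.Icc b a, (if c = b then u else v) * y ^ c =
      u * y ^ b + v * ∑ c ∈ Finset.Ioc b a, y ^ c := by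
  rw [← Finset.Ioc_insert_left hab, Finset.sum_insert (by simp), Finset.mul_sum]
  congr 1
  · simp
  · exact Finset.sum_congr rfl fun c hc => by
      rw [if_neg (by have := (Finset.mem_Ioc.1 hc).1; omega)]

/-- The pattern polynomials are combinations of the interlacing monomials, with coefficients that
are uniformly bounded below and above. -/
lemma exists_patternPoly_coeff {t : ℝ} (h0 : 0 ≤ t) (h1 : t ≤ 1) {m : ℕ → ℕ} (hm : Antitone m)
    (j : ℕ) :
    ∃ φ ψ : (Fin j → ℕ) → ℝ,
      (∀ μ, (1 - t) ^ j ≤ φ μ ∧ φ μ ≤ (1 + t) ^ j ∧ 0 ≤ ψ μ ∧ ψ μ ≤ φ μ) ∧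
      ∀ y : ℕ → ℂ, patternPoly (t : ℂ) m y j =
        (∑ μ ∈ interlacing (fun i : Fin (j + 1) => m i), (φ μ : ℂ) * ∏ i : Fin j, y i ^ μ i,
          ∑ μ ∈ interlacing (fun i : Fin (j + 1) => m i), (ψ μ : ℂ) * ∏ i : Fin j, y i ^ μ i) := by
  induction j with
  | zero =>
    refine ⟨fun _ => 1, fun _ => 1, fun μ => by simp, fun y => ?_⟩
    simp [patternPoly, interlacing]
  | succ j ih =>
    obtain ⟨φ, ψ, hb, hy⟩ := ih
    refine ⟨fun μ => φ (Fin.init μ) * (if μ (Fin.last j) = m (j + 1) then 1 else 1 - t) +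
        (if μ (Fin.last j) = m j then t else 0) * ψ (Fin.init μ),
      fun μ => φ (Fin.init μ) * (if μ (Fin.last j) = m (j + 1) then 0 else 1 - t) +
        (if μ (Fin.last j) = m j then t else 0) * ψ (Fin.init μ), fun μ => ?_, fun y => ?_⟩
    · obtain ⟨hl, hu, hp, hle⟩ := hb (Fin.init μ)
      have hφ : 0 ≤ φ (Fin.init μ) := hp.trans hle
      have h1t : 0 ≤ 1 - t := by linarith
      have a1 : (if μ (Fin.last j) = m j then t else 0) * ψ (Fin.init μ) ≤ t * φ (Fin.init μ) := by
        split_ifs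
        · exact mul_le_mul_of_nonneg_left hle h0
        · simpa using mul_nonneg h0 hφ
      have a2 : 0 ≤ (if μ (Fin.last j) = m j then t else 0) * ψ (Fin.init μ) := by
        split_ifs
        · exact mul_nonneg h0 hp
        · simp
      have a3 : φ (Fin.init μ) * (1 - t) ≤
          φ (Fin.init μ) * (if μ (Fin.last j) = m (j + 1) then 1 else 1 - t) := by
        apply mul_le_mul_of_nonneg_left _ hφ
        split_ifs <;> linarith
      have a4 : φ (Fin.init μ) * (if μ (Fin.last j) = m (j + 1) then 1 else 1 - t) ≤
          φ (Fin.init μ) := by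
        apply mul_le_of_le_one_right hφ
        split_ifs <;> linarith
      have a5 : φ (Fin.init μ) * (if μ (Fin.last j) = m (j + 1) then 0 else 1 - t) ≤
          φ (Fin.init μ) * (if μ (Fin.last j) = m (j + 1) then 1 else 1 - t) := by
        apply mul_le_mul_of_nonneg_left _ hφ
        split_ifs <;> linarith
      have a6 : 0 ≤ φ (Fin.init μ) * (if μ (Fin.last j) = m (j + 1) then 0 else 1 - t) := by
        apply mul_nonneg hφ
        split_ifs <;> linarith
      refine ⟨?_, ?_, by linarith, by linarith⟩
      · rw [pow_succ]
        nlinarith [mul_le_mul_of_nonneg_right hl h1t]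
      · rw [pow_succ]
        nlinarith [mul_le_mul_of_nonneg_right hu (show 0 ≤ 1 + t by linarith)]
    · have hab : m (j + 1) ≤ m j := hm j.le_succ
      have hlast : ∑ c ∈ Finset.Icc (m (j + 1)) (m j), (if c = m j then (t : ℂ) else 0) * y j ^ c =
          t * y j ^ m j := by
        rw [Finset.sum_eq_single (m j)]
        · simp
        · intro c _ hc; simp [hc]
        · intro h; simp [hab] at h
      have key (u v : ℂ) : ∑ μ ∈ interlacing (fun i : Fin (j + 2) => m i),
          ((φ (Fin.init μ) : ℂ) * (if μ (Fin.last j) = m (j + 1) then u else v) +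
            (if μ (Fin.last j) = m j then (t : ℂ) else 0) * ψ (Fin.init μ)) * ∏ i : Fin (j + 1), y i ^ μ i =
          (patternPoly (t : ℂ) m y j).1 *
            (u * y j ^ m (j + 1) + v * ∑ c ∈ Finset.Ioc (m (j + 1)) (m j), y j ^ c) +
          (t * y j ^ m j) * (patternPoly (t : ℂ) m y j).2 := by
        have := sum_interlacing_succ (fun i : Fin (j + 2) => m i) fun ν c =>
          ((φ ν : ℂ) * (if c = m (j + 1) then u else v) +
            (if c = m j then (t : ℂ) else 0) * ψ ν) * ((∏ i : Fin j, y i ^ ν i) * y j ^ c)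
        simp only [Fin.prod_univ_castSucc]
        refine this.trans ?_
        rw [hy, ← sum_Icc_ite hab, ← hlast, mul_comm (∑ c ∈ _, _) (Prod.snd _),
          Finset.sum_mul_sum, Finset.sum_mul_sum, ← Finset.sum_add_distrib]
        refine Finset.sum_congr rfl fun ν _ => ?_
        rw [← Finset.sum_add_distrib]
        refine Finset.sum_congr (by simp) fun c _ => ?_
        ring
      have k1 := key 1 (1 - t)
      have k2 := key 0 (1 - t)
      refine Prod.ext ?_ ?_
      · simp only [patternPoly, upperSum]
        rw [one_mul] at k1
        rw [← k1]
        refine Finset.sum_congr rfl fun μ _ => ?_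
        split_ifs <;> push_cast <;> rfl
      · simp only [patternPoly, upperSum]
        rw [zero_mul, zero_add] at k2
        rw [← k2]
        refine Finset.sum_congr rfl fun μ _ => ?_
        split_ifs <;> push_cast <;> rfl

/-- The branching rule: setting a variable equal to `1` expands a Hall–Littlewood polynomial into
those of the interlacing exponents, with coefficients between `(1 - t) ^ n` and `(1 + t) ^ n`. -/
theorem exists_branching {t : ℝ} (h0 : 0 ≤ t) (h1 : t ≤ 1) {m : Fin (n + 1) → ℕ}
    (hm : Antitone m) :
    ∃ φ : (Fin n → ℕ) → ℝ, (∀ μ, (1 - t) ^ n ≤ φ μ ∧ φ μ ≤ (1 + t) ^ n) ∧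
      ∀ x : Fin n → ℂ, Function.Injective x → (∀ i, x i ≠ 1) →
        hallLittlewood (t : ℂ) m (Fin.cons 1 x) =
          ∑ μ ∈ interlacing m, (φ μ : ℂ) * hallLittlewood (t : ℂ) μ x := by
  set M : ℕ → ℕ := fun i => if h : i < n + 1 then m ⟨i, h⟩ else 0 with hMdef
  have hM : Antitone M := by
    intro a b hab
    simp only [hMdef]
    split_ifs with hb ha
    · exact hm hab
    · omega
    · exact Nat.zero_le _
    · exact le_rfl
  have hMm : (fun i : Fin (n + 1) => M i) = m := by
    funext i
    simp only [hMdef, dif_pos i.2]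
  obtain ⟨φ, ψ, hb, hy⟩ := exists_patternPoly_coeff h0 h1 hM n
  refine ⟨φ, fun μ => ⟨(hb μ).1, (hb μ).2.1⟩, fun x hx hx1 => ?_⟩
  have := hallLittlewood_cons_one (t : ℂ) hM hx hx1
  rw [hMm] at this
  rw [this]
  simp only [hy, hMm, symmetrize_sum, symmetrize_const_mul]
  refine Finset.sum_congr rfl fun μ _ => ?_
  rw [hallLittlewood]
  congr 2
  funext y
  exact Finset.prod_congr rfl fun i _ => by rw [toSeq_of_lt _ i.2]

/-! ### The value at the singular point `(1, …, 1)` -/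

lemma hallLittlewood_smul (t : ℂ) (m : Fin n → ℕ) {c : ℂ} (hc : c ≠ 0) (x : Fin n → ℂ) :
    hallLittlewood t m (fun i => c * x i) = c ^ (∑ i, m i) * hallLittlewood t m x := by
  rw [hallLittlewood, symmetrize, symmetrize, Finset.mul_sum]
  refine Finset.sum_congr rfl fun σ _ => ?_
  have hk : kernel t ((fun i => c * x i) ∘ σ) = kernel t (x ∘ σ) := by
    refine Finset.prod_congr rfl fun i _ => Finset.prod_congr rfl fun j _ => ?_
    simp only [Function.comp_apply]
    rw [show c * x (σ i) - t * (c * x (σ j)) = c * (x (σ i) - t * x (σ j)) by ring, ← mul_sub,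
      mul_div_mul_left _ _ hc]
  rw [hk, ← mul_assoc]
  congr 1
  simp only [Function.comp_apply, mul_pow, Finset.prod_mul_distrib, Finset.prod_pow_eq_pow_sum]

/-- The points with distinct coordinates. -/
def distinctPoints (n : ℕ) : Set (Fin n → ℂ) := {x | Function.Injective x}

/-- The limits of Hall–Littlewood polynomials at `(1, …, 1)` branch like the polynomials. -/
lemma tendsto_hallLittlewood_of_branching {t : ℝ} {m : Fin (n + 1) → ℕ}
    {φ : (Fin n → ℕ) → ℝ}
    (hφ : ∀ x : Fin n → ℂ, Function.Injective x → (∀ i, x i ≠ 1) →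
        hallLittlewood (t : ℂ) m (Fin.cons 1 x) =
          ∑ μ ∈ interlacing m, (φ μ : ℂ) * hallLittlewood (t : ℂ) μ x)
    {h : (Fin n → ℕ) → ℝ}
    (hh : ∀ μ ∈ interlacing m, Filter.Tendsto (hallLittlewood (t : ℂ) μ)
      (𝓝[distinctPoints n] 1) (𝓝 (h μ))) :
    Filter.Tendsto (hallLittlewood (t : ℂ) m) (𝓝[distinctPoints (n + 1)] 1)
      (𝓝 ((∑ μ ∈ interlacing m, φ μ * h μ : ℝ) : ℂ)) := by
  set g : (Fin (n + 1) → ℂ) → (Fin n → ℂ) := fun x i => x i.succ / x 0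
  have hx0 : ∀ᶠ x : Fin (n + 1) → ℂ in 𝓝[distinctPoints (n + 1)] 1, x 0 ≠ 0 := by
    apply eventually_nhdsWithin_of_eventually_nhds
    exact (continuous_apply (0 : Fin (n + 1))).continuousAt.eventually_ne (by simp)
  have hg : Filter.Tendsto g (𝓝[distinctPoints (n + 1)] 1) (𝓝[distinctPoints n] 1) := by
    refine tendsto_nhdsWithin_iff.2 ⟨?_, ?_⟩
    · refine Filter.Tendsto.mono_left ?_ nhdsWithin_le_nhds
      rw [tendsto_pi_nhds]
      intro i
      have : ContinuousAt (fun x : Fin (n + 1) → ℂ => x i.succ / x 0) 1 :=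
        ((continuous_apply i.succ).continuousAt).div (continuous_apply 0).continuousAt (by simp)
      simpa [ContinuousAt, g] using this
    · filter_upwards [hx0, self_mem_nhdsWithin] with x h0 hx i j hij
      have : x i.succ = x j.succ := by simpa [g, div_left_inj' h0] using hij
      exact Fin.succ_injective _ (hx this)
  have hlim : Filter.Tendsto (fun x : Fin (n + 1) → ℂ => x 0 ^ (∑ i, m i) *
      ∑ μ ∈ interlacing m, (φ μ : ℂ) * hallLittlewood (t : ℂ) μ (g x))
      (𝓝[distinctPoints (n + 1)] 1)
      (𝓝 ((1 : ℂ) ^ (∑ i, m i) * ∑ μ ∈ interlacing m, (φ μ : ℂ) * h μ)) := by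
    refine Filter.Tendsto.mul ?_ ?_
    · refine Filter.Tendsto.pow ?_ _
      exact ((continuous_apply (0 : Fin (n + 1))).tendsto' 1 1 rfl).mono_left nhdsWithin_le_nhds
    · exact tendsto_finsetSum _ fun μ hμ => ((hh μ hμ).comp hg).const_mul _
  have hval : ((∑ μ ∈ interlacing m, φ μ * h μ : ℝ) : ℂ) =
      (1 : ℂ) ^ (∑ i, m i) * ∑ μ ∈ interlacing m, (φ μ : ℂ) * h μ := by
    push_cast; ring
  rw [hval]
  refine hlim.congr' ?_
  filter_upwards [hx0, self_mem_nhdsWithin] with x h0 hx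
  have hcons : x = fun i => x 0 * (Fin.cons 1 (g x) : Fin (n + 1) → ℂ) i := by
    funext i
    induction i using Fin.cases with
    | zero => simp
    | succ i => simp [g, mul_div_cancel₀ _ h0]
  conv_rhs => rw [hcons]
  rw [hallLittlewood_smul _ _ h0, hφ]
  · intro i j hij
    have : x i.succ = x j.succ := by simpa [g, div_left_inj' h0] using hij
    exact Fin.succ_injective _ (hx this)
  · intro i hi
    have : x i.succ = x 0 := by simpa [g, div_eq_one_iff_eq h0] using hi
    exact Fin.succ_ne_zero i (hx this)

lemma exists_tendsto_hallLittlewood {t : ℝ} (h0 : 0 ≤ t) (h1 : t ≤ 1) {m : Fin n → ℕ}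
    (hm : Antitone m) :
    ∃ h : ℝ, Filter.Tendsto (hallLittlewood (t : ℂ) m) (𝓝[distinctPoints n] 1) (𝓝 (h : ℂ)) := by
  induction n with
  | zero =>
    refine ⟨1, tendsto_const_nhds.congr fun x => ?_⟩
    simp [hallLittlewood, symmetrize, kernel]
  | succ n ih =>
    obtain ⟨φ, -, hφ⟩ := exists_branching h0 h1 hm
    choose! h hh using fun μ (hμ : μ ∈ interlacing m) => ih (antitone_of_mem_interlacing hm hμ)
    exact ⟨_, tendsto_hallLittlewood_of_branching hφ hh⟩

/-! ### Expansion into alternants -/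

/-- The pairs `i < j` of indices, i.e. the positive roots of type `A`. -/
def pairs (n : ℕ) : Finset (Fin n × Fin n) := {p | p.1 < p.2}

@[simp] lemma mem_pairs {p : Fin n × Fin n} : p ∈ pairs n ↔ p.1 < p.2 := by simp [pairs]

lemma prod_pairs {M : Type*} [CommMonoid M] (f : Fin n → Fin n → M) :
    ∏ p ∈ pairs n, f p.1 p.2 = ∏ i, ∏ j, if i < j then f i j else 1 := by
  rw [pairs, Finset.prod_filter, ← Finset.univ_product_univ, Finset.prod_product]

lemma prod_pairs_sub {R : Type*} [CommRing R] (x : Fin n → R) :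
    ∏ p ∈ pairs n, (x p.2 - x p.1) = (Matrix.vandermonde x).det := by
  rw [Matrix.det_vandermonde, prod_pairs fun i j => x j - x i]
  refine Finset.prod_congr rfl fun i _ => ?_
  rw [← Finset.prod_filter]
  congr 1
  ext j; simp

lemma prod_pairs_sub_comp {R : Type*} [CommRing R] (x : Fin n → R) (σ : Equiv.Perm (Fin n)) :
    ∏ p ∈ pairs n, (x (σ p.1) - x (σ p.2)) =
      (Equiv.Perm.sign σ : ℤ) * ∏ p ∈ pairs n, (x p.1 - x p.2) := by
  have h (y : Fin n → R) : ∏ p ∈ pairs n, (y p.1 - y p.2) =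
      (Matrix.vandermonde fun i => -y i).det := by
    rw [← prod_pairs_sub]
    exact Finset.prod_congr rfl fun p _ => by ring
  have h1 := h (x ∘ σ)
  simp only [Function.comp_apply] at h1
  rw [h1, h, ← Matrix.det_permute]
  rfl

/-- The exponents of the monomial picked from `∏_{i < j} (x_i - t x_j)` by choosing `- t x_j` at the
pairs in `S` and `x_i` at the others. -/
def shift (S : Finset (Fin n × Fin n)) (i : Fin n) : ℕ :=
  (S.filter fun p => p.2 = i).card + ((pairs n \ S).filter fun p => p.1 = i).card

lemma prod_pairs_sub_mul (t : ℂ) (y : Fin n → ℂ) :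
    ∏ p ∈ pairs n, (y p.1 - t * y p.2) =
      ∑ S ∈ (pairs n).powerset, (-t) ^ S.card * ∏ i, y i ^ shift S i := by
  have h : ∏ p ∈ pairs n, (y p.1 - t * y p.2) = ∏ p ∈ pairs n, ((-t) * y p.2 + y p.1) :=
    Finset.prod_congr rfl fun p _ => by ring
  rw [h, Finset.prod_add]
  refine Finset.sum_congr rfl fun S _ => ?_
  rw [Finset.prod_mul_distrib, Finset.prod_const, mul_assoc]
  congr 1
  simp only [shift, pow_add, Finset.prod_mul_distrib]
  congr 1
  · rw [← Finset.prod_fiberwise S (fun p => p.2)]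
    refine Finset.prod_congr rfl fun i _ => ?_
    rw [Finset.prod_congr rfl fun p hp => by rw [(Finset.mem_filter.1 hp).2], Finset.prod_const]
  · rw [← Finset.prod_fiberwise (pairs n \ S) (fun p => p.1)]
    refine Finset.prod_congr rfl fun i _ => ?_
    rw [Finset.prod_congr rfl fun p hp => by rw [(Finset.mem_filter.1 hp).2], Finset.prod_const]

/-- A Hall–Littlewood polynomial is a combination of quotients of alternants. -/
lemma hallLittlewood_eq_sum_det (t : ℂ) (m : Fin n → ℕ) (x : Fin n → ℂ) :
    hallLittlewood t m x = ∑ S ∈ (pairs n).powerset, (-t) ^ S.card *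
      ((Matrix.of fun i j => x i ^ (m j + shift S j)).det / ∏ p ∈ pairs n, (x p.1 - x p.2)) := by
  have hk (σ : Equiv.Perm (Fin n)) : kernel t (x ∘ σ) =
      (Equiv.Perm.sign σ : ℤ) * (∏ p ∈ pairs n, (x (σ p.1) - t * x (σ p.2))) /
        ∏ p ∈ pairs n, (x p.1 - x p.2) := by
    have : kernel t (x ∘ σ) =
        ∏ p ∈ pairs n, (x (σ p.1) - t * x (σ p.2)) / (x (σ p.1) - x (σ p.2)) := by
      rw [prod_pairs fun i j => (x (σ i) - t * x (σ j)) / (x (σ i) - x (σ j))]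
      rfl
    rw [this, Finset.prod_div_distrib, prod_pairs_sub_comp]
    rcases Int.units_eq_one_or (Equiv.Perm.sign σ) with h | h <;> rw [h]
    · simp
    · simp [div_neg, neg_div]
  simp only [← mul_div_assoc, ← Finset.sum_div, Matrix.det_apply', Finset.mul_sum, Matrix.of_apply]
  rw [Finset.sum_comm, Finset.sum_div]
  refine Finset.sum_congr rfl fun σ _ => ?_
  have := prod_pairs_sub_mul t (x ∘ σ)
  simp only [Function.comp_apply] at this
  rw [hk, this, ← mul_div_assoc]
  congr 1
  rw [Finset.mul_sum, Finset.mul_sum]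
  refine Finset.sum_congr rfl fun S _ => ?_
  simp only [pow_add, Finset.prod_mul_distrib, Function.comp_apply]
  ring

/-- The value at `(1, …, 1)` of the Hall–Littlewood polynomial of exponent `m`, as a combination of
Weyl dimension polynomials. -/
def valueAtOne (t : ℝ) (m : Fin n → ℕ) : ℝ :=
  ∑ S ∈ (pairs n).powerset, (-t) ^ S.card *
    ∏ p ∈ pairs n, (((m p.1 + shift S p.1 : ℕ) : ℝ) - ((m p.2 + shift S p.2 : ℕ) : ℝ)) /
      (((p.2 : ℕ) : ℝ) - ((p.1 : ℕ) : ℝ))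

lemma tendsto_pow_sub_pow_div (a b c d : ℕ) (hcd : c ≠ d) :
    Filter.Tendsto (fun s : ℝ => ((s : ℂ) ^ a - (s : ℂ) ^ b) / ((s : ℂ) ^ c - (s : ℂ) ^ d))
      (𝓝[>] 1) (𝓝 ((((a : ℝ) - b) / ((c : ℝ) - d) : ℝ) : ℂ)) := by
  have hs (a b : ℕ) : Filter.Tendsto (fun s : ℝ => (s ^ a - s ^ b) / (s - 1)) (𝓝[>] 1)
      (𝓝 ((a : ℝ) - b)) := by
    have h : HasDerivAt (fun s : ℝ => s ^ a - s ^ b) ((a : ℝ) - b) 1 := by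
      have := (hasDerivAt_pow a (1 : ℝ)).fun_sub (hasDerivAt_pow b (1 : ℝ))
      simpa only [one_pow, mul_one] using this
    have h2 := h.tendsto_slope.mono_left
      (nhdsWithin_mono 1 fun s (hs : s ∈ Set.Ioi (1 : ℝ)) => ne_of_gt hs)
    refine h2.congr fun s => ?_
    simp [slope_def_field]
  have hne : (c : ℝ) - d ≠ 0 := sub_ne_zero.2 (by exact_mod_cast hcd)
  have h := (hs a b).div (hs c d) hne
  refine ((Complex.continuous_ofReal.tendsto _).comp h).congr' ?_
  filter_upwards [self_mem_nhdsWithin] with s hs1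
  have : s - 1 ≠ 0 := sub_ne_zero.2 (ne_of_gt hs1)
  simp only [Function.comp_apply, Pi.div_apply]
  rw [div_div_div_cancel_right₀ this]
  push_cast
  rfl

/-- Along the principal specialization `x_i = s ^ i` the alternants are Vandermonde determinants. -/
lemma tendsto_hallLittlewood_pow (t : ℝ) (m : Fin n → ℕ) :
    Filter.Tendsto (fun s : ℝ => hallLittlewood (t : ℂ) m fun i : Fin n => (s : ℂ) ^ (i : ℕ))
      (𝓝[>] 1) (𝓝 (valueAtOne t m : ℂ)) := by
  simp only [hallLittlewood_eq_sum_det, valueAtOne]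
  push_cast
  refine tendsto_finsetSum _ fun S _ => Filter.Tendsto.const_mul _ ?_
  have hdet (s : ℝ) : (Matrix.of fun i j : Fin n =>
      ((s : ℂ) ^ (i : ℕ)) ^ (m j + shift S j)).det =
      ∏ p ∈ pairs n, ((s : ℂ) ^ (m p.2 + shift S p.2) - (s : ℂ) ^ (m p.1 + shift S p.1)) := by
    rw [prod_pairs_sub fun j : Fin n => (s : ℂ) ^ (m j + shift S j), ← Matrix.det_transpose]
    congr 1
    ext i j
    simp [Matrix.vandermonde_apply, ← pow_mul, mul_comm]
  simp only [hdet, ← Finset.prod_div_distrib]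
  refine tendsto_finsetProd _ fun p hp => ?_
  have hlt := mem_pairs.1 hp
  have := tendsto_pow_sub_pow_div (m p.2 + shift S p.2) (m p.1 + shift S p.1) p.1 p.2
    (by have := Fin.lt_def.1 hlt; omega)
  convert this using 2
  push_cast
  rw [← neg_sub, ← neg_sub ((p.1 : ℕ) : ℂ), neg_div_neg_eq]

/-- The principal specialization runs through points with distinct coordinates. -/
lemma tendsto_pow_distinctPoints :
    Filter.Tendsto (fun (s : ℝ) (i : Fin n) => (s : ℂ) ^ (i : ℕ)) (𝓝[>] 1)
      (𝓝[distinctPoints n] 1) := by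
  refine tendsto_nhdsWithin_iff.2 ⟨?_, ?_⟩
  · refine Filter.Tendsto.mono_left ?_ nhdsWithin_le_nhds
    have : Continuous fun (s : ℝ) (i : Fin n) => (s : ℂ) ^ (i : ℕ) := by fun_prop
    exact this.tendsto' _ _ (by ext; simp)
  · filter_upwards [self_mem_nhdsWithin] with s hs i j hij
    have hs1 : (1 : ℝ) < s := hs
    have : s ^ (i : ℕ) = s ^ (j : ℕ) := by
      dsimp only at hij
      exact_mod_cast hij
    exact Fin.ext (pow_right_injective₀ (by linarith) hs1.ne' this)

/-- A Hall–Littlewood polynomial of dominant exponent extends continuously to `(1, …, 1)`. -/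
theorem tendsto_hallLittlewood {t : ℝ} (h0 : 0 ≤ t) (h1 : t ≤ 1) {m : Fin n → ℕ}
    (hm : Antitone m) :
    Filter.Tendsto (hallLittlewood (t : ℂ) m) (𝓝[distinctPoints n] 1)
      (𝓝 (valueAtOne t m : ℂ)) := by
  obtain ⟨h, hh⟩ := exists_tendsto_hallLittlewood h0 h1 hm
  rw [← tendsto_nhds_unique (hh.comp tendsto_pow_distinctPoints) (tendsto_hallLittlewood_pow t m)]
  exact hh

lemma neBot_distinctPoints : (𝓝[distinctPoints n] (1 : Fin n → ℂ)).NeBot :=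
  tendsto_pow_distinctPoints.neBot

/-! ### Bounds and asymptotics of the value at `(1, …, 1)` -/

lemma exists_valueAtOne_succ {t : ℝ} (h0 : 0 ≤ t) (h1 : t ≤ 1) {m : Fin (n + 1) → ℕ}
    (hm : Antitone m) :
    ∃ φ : (Fin n → ℕ) → ℝ, (∀ μ, (1 - t) ^ n ≤ φ μ ∧ φ μ ≤ (1 + t) ^ n) ∧
      valueAtOne t m = ∑ μ ∈ interlacing m, φ μ * valueAtOne t μ := by
  obtain ⟨φ, hb, hφ⟩ := exists_branching h0 h1 hm
  refine ⟨φ, hb, ?_⟩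
  have := neBot_distinctPoints (n := n + 1)
  have h := tendsto_nhds_unique (tendsto_hallLittlewood h0 h1 hm)
    (tendsto_hallLittlewood_of_branching hφ fun μ hμ =>
      tendsto_hallLittlewood h0 h1 (antitone_of_mem_interlacing hm hμ))
  exact_mod_cast h

/-- For `t = 0` this is Weyl's dimension formula. -/
lemma valueAtOne_zero_eq (m : Fin n → ℕ) :
    valueAtOne 0 m = ∏ p ∈ pairs n, ((m p.1 : ℝ) - m p.2 + (((p.2 : ℕ) : ℝ) - ((p.1 : ℕ) : ℝ))) /
      (((p.2 : ℕ) : ℝ) - ((p.1 : ℕ) : ℝ)) := by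
  have hs (i : Fin n) : shift (∅ : Finset (Fin n × Fin n)) i = n - 1 - i := by
    have : (pairs n).filter (fun p => p.1 = i) = (Finset.Ioi i).map
        ⟨fun j => (i, j), fun a b h => (Prod.ext_iff.1 h).2⟩ := by
      ext p
      simp only [Finset.mem_filter, mem_pairs, Finset.mem_map, Finset.mem_Ioi]
      constructor
      · rintro ⟨h, rfl⟩; exact ⟨p.2, h, rfl⟩
      · rintro ⟨c, h, rfl⟩; exact ⟨h, rfl⟩
    rw [shift]
    simp [this, Fin.card_Ioi]
  rw [valueAtOne, Finset.sum_eq_single ∅]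
  · simp only [Finset.card_empty, pow_zero, one_mul, hs]
    refine Finset.prod_congr rfl fun p _ => ?_
    congr 1
    have e (i : Fin n) : ((m i + (n - 1 - i) : ℕ) : ℝ) = m i + ((n : ℝ) - 1 - ((i : ℕ) : ℝ)) := by
      have := i.2
      rw [Nat.cast_add, Nat.sub_sub, Nat.cast_sub (by omega)]
      push_cast; ring
    rw [e, e]; ring
  · intro S _ hS
    rw [neg_zero, zero_pow (by simpa using hS), zero_mul]
  · simp

lemma valueAtOne_zero_nonneg {m : Fin n → ℕ} (hm : Antitone m) : 0 ≤ valueAtOne 0 m := by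
  rw [valueAtOne_zero_eq]
  refine Finset.prod_nonneg fun p hp => ?_
  have hlt := mem_pairs.1 hp
  have h1 : (m p.2 : ℝ) ≤ m p.1 := by exact_mod_cast hm hlt.le
  have h2 : ((p.1 : ℕ) : ℝ) < ((p.2 : ℕ) : ℝ) := by exact_mod_cast hlt
  exact div_nonneg (by linarith) (by linarith)

/-- Comparison with the case `t = 0`, where the branching coefficients are all `1`. -/
lemma exists_le_valueAtOne (n : ℕ) {t : ℝ} (h0 : 0 ≤ t) (h1 : t < 1) :
    ∃ c : ℝ, 0 < c ∧ ∀ m : Fin n → ℕ, Antitone m → c * valueAtOne 0 m ≤ valueAtOne t m := by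
  induction n with
  | zero =>
    refine ⟨1, one_pos, fun m _ => ?_⟩
    simp [valueAtOne, pairs]
  | succ n ih =>
    obtain ⟨c, hc, h⟩ := ih
    have h1t : 0 < 1 - t := by linarith
    refine ⟨(1 - t) ^ n * c, by positivity, fun m hm => ?_⟩
    obtain ⟨φ, hb, hφ⟩ := exists_valueAtOne_succ h0 h1.le hm
    obtain ⟨φ', hb', hφ'⟩ := exists_valueAtOne_succ le_rfl zero_le_one hm
    rw [hφ, hφ', Finset.mul_sum]
    refine Finset.sum_le_sum fun μ hμ => ?_
    have hμa := antitone_of_mem_interlacing hm hμ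
    have e : φ' μ = 1 := le_antisymm (by simpa using (hb' μ).2) (by simpa using (hb' μ).1)
    have hn := mul_nonneg hc.le (valueAtOne_zero_nonneg hμa)
    rw [e, one_mul, mul_assoc]
    exact mul_le_mul (hb μ).1 (h μ hμa) hn ((pow_nonneg h1t.le n).trans (hb μ).1)

/-- The lower bound for the value at `(1, …, 1)`. -/
theorem exists_lower_bound (n : ℕ) {t : ℝ} (h0 : 0 ≤ t) (h1 : t < 1) :
    ∃ c : ℝ, 0 < c ∧ ∀ m : Fin n → ℕ, Antitone m →
      c * ∏ p ∈ pairs n, (1 + ((m p.1 : ℝ) - m p.2)) ≤ valueAtOne t m := by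
  obtain ⟨c, hc, h⟩ := exists_le_valueAtOne n h0 h1
  have hd : 0 < ∏ p ∈ pairs n, (((p.2 : ℕ) : ℝ) - ((p.1 : ℕ) : ℝ)) :=
    Finset.prod_pos fun p hp => sub_pos.2 (by exact_mod_cast mem_pairs.1 hp)
  refine ⟨c / ∏ p ∈ pairs n, (((p.2 : ℕ) : ℝ) - ((p.1 : ℕ) : ℝ)), div_pos hc hd,
    fun m hm => le_trans ?_ (h m hm)⟩
  rw [valueAtOne_zero_eq, Finset.prod_div_distrib, div_mul_eq_mul_div, ← mul_div_assoc]
  refine div_le_div_of_nonneg_right (mul_le_mul_of_nonneg_left ?_ hc.le) hd.le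
  refine Finset.prod_le_prod (fun p hp => ?_) fun p hp => ?_
  · have h1 : (m p.2 : ℝ) ≤ m p.1 := by exact_mod_cast hm (mem_pairs.1 hp).le
    linarith
  · have h2 : ((p.1 : ℕ) : ℝ) + 1 ≤ ((p.2 : ℕ) : ℝ) := by exact_mod_cast mem_pairs.1 hp
    linarith

/-- The upper bound for the value at `(1, …, 1)`, term by term. -/
theorem exists_upper_bound (n : ℕ) (t : ℝ) :
    ∃ C : ℝ, 0 < C ∧ ∀ m : Fin n → ℕ, Antitone m →
      valueAtOne t m ≤ C * ∏ p ∈ pairs n, (1 + ((m p.1 : ℝ) - m p.2)) := by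
  set A : Finset (Fin n × Fin n) → ℝ := fun S =>
    |(-t) ^ S.card| * ∏ p ∈ pairs n, (1 + |(shift S p.1 : ℝ) - shift S p.2|)
  have hA (S) : 0 ≤ A S := mul_nonneg (abs_nonneg _) (Finset.prod_nonneg fun p _ => by positivity)
  refine ⟨1 + ∑ S ∈ (pairs n).powerset, A S,
    add_pos_of_pos_of_nonneg one_pos (Finset.sum_nonneg fun S _ => hA S), fun m hm => ?_⟩
  have hnn : ∀ p ∈ pairs n, 0 ≤ (m p.1 : ℝ) - m p.2 := fun p hp =>
    sub_nonneg.2 (by exact_mod_cast hm (mem_pairs.1 hp).le)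
  have hP : 0 ≤ ∏ p ∈ pairs n, (1 + ((m p.1 : ℝ) - m p.2)) :=
    Finset.prod_nonneg fun p hp => by linarith [hnn p hp]
  have hS : valueAtOne t m ≤ ∑ S ∈ (pairs n).powerset,
      A S * ∏ p ∈ pairs n, (1 + ((m p.1 : ℝ) - m p.2)) := by
    refine Finset.sum_le_sum fun S _ => (le_abs_self _).trans ?_
    rw [abs_mul, mul_assoc, Finset.abs_prod, ← Finset.prod_mul_distrib]
    refine mul_le_mul_of_nonneg_left ?_ (abs_nonneg _)
    refine Finset.prod_le_prod (fun _ _ => abs_nonneg _) fun p hp => ?_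
    have h2 : ((p.1 : ℕ) : ℝ) + 1 ≤ ((p.2 : ℕ) : ℝ) := by exact_mod_cast mem_pairs.1 hp
    have h3 := hnn p hp
    have h4 := abs_nonneg ((shift S p.1 : ℝ) - shift S p.2)
    rw [abs_div]
    refine (div_le_self (abs_nonneg _) ?_).trans ?_
    · rw [abs_of_nonneg] <;> linarith
    · push_cast
      rw [show (m p.1 : ℝ) + shift S p.1 - (m p.2 + shift S p.2) =
        ((m p.1 : ℝ) - m p.2) + ((shift S p.1 : ℝ) - shift S p.2) by ring]
      refine (abs_add_le _ _).trans ?_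
      rw [abs_of_nonneg h3]
      nlinarith
  refine hS.trans ?_
  rw [← Finset.sum_mul]
  exact mul_le_mul_of_nonneg_right (by linarith) hP

/-- The leading constant of the value at `(1, …, 1)`. -/
def leadingCoeff (n : ℕ) (t : ℝ) : ℝ :=
  (1 - t) ^ (pairs n).card / ∏ p ∈ pairs n, (((p.2 : ℕ) : ℝ) - ((p.1 : ℕ) : ℝ))

lemma leadingCoeff_pos (n : ℕ) {t : ℝ} (h1 : t < 1) : 0 < leadingCoeff n t :=
  div_pos (pow_pos (by linarith) _)
    (Finset.prod_pos fun p hp => sub_pos.2 (by exact_mod_cast mem_pairs.1 hp))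

/-- All the terms of `valueAtOne` have a multiple of `∏_{i < j} (m_i - m_j)` as leading part, and the
factors add up to `leadingCoeff`. -/
theorem tendsto_valueAtOne_div (t : ℝ) {α : Type*} {F : Filter α} {m : α → Fin n → ℕ}
    (hm : ∀ p ∈ pairs n, Filter.Tendsto (fun a => (m a p.1 : ℝ) - m a p.2) F Filter.atTop) :
    Filter.Tendsto (fun a => valueAtOne t (m a) / ∏ p ∈ pairs n, ((m a p.1 : ℝ) - m a p.2)) F
      (𝓝 (leadingCoeff n t)) := by
  have hlead : leadingCoeff n t = ∑ S ∈ (pairs n).powerset, (-t) ^ S.card *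
      ∏ p ∈ pairs n, 1 / (((p.2 : ℕ) : ℝ) - ((p.1 : ℕ) : ℝ)) := by
    rw [← Finset.sum_mul, leadingCoeff]
    have := Finset.prod_add (fun _ : Fin n × Fin n => -t) (fun _ => 1) (pairs n)
    simp only [Finset.prod_const, one_pow, mul_one] at this
    rw [← this, neg_add_eq_sub, Finset.prod_div_distrib, Finset.prod_const_one, mul_one_div]
  rw [hlead]
  simp only [valueAtOne, Finset.sum_div, mul_div_assoc, ← Finset.prod_div_distrib]
  refine tendsto_finsetSum _ fun S _ => Filter.Tendsto.const_mul _ ?_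
  refine tendsto_finsetProd _ fun p hp => ?_
  have h := ((hm p hp).inv_tendsto_atTop.const_mul ((shift S p.1 : ℝ) - shift S p.2)).const_add 1
  rw [mul_zero, add_zero] at h
  refine (h.div_const (((p.2 : ℕ) : ℝ) - ((p.1 : ℕ) : ℝ))).congr' ?_
  filter_upwards [(hm p hp).eventually_gt_atTop 0] with a ha
  rw [div_right_comm]
  congr 1
  simp only [Pi.inv_apply]
  push_cast
  field_simp
  ring

end HallLittlewood

namespace MacdonaldSpherical

open HallLittlewood

/-! ### Standard coordinates on a root system of type `A` -/

section Coordinates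

variable {ι V : Type*} [NormedAddCommGroup V] [InnerProductSpace ℝ V]
  {r : ℕ} {R : RootPairing ι ℝ V V} {b : R.Base}

lemma IsTypeA.coroot_eq_root (hA : IsTypeA r R b) (i : ι) : R.coroot i = R.root i := by
  rw [hA.coroot_eq, hA.norm_sq_root, div_self two_ne_zero, one_smul]

lemma IsTypeA.pairing_eq (hA : IsTypeA r R b) (i j : ι) :
    R.pairing i j = inner ℝ (R.root i) (R.root j) := by
  rw [← hA.coroot_eq_root j, ← hA.pairing_eq_inner]
  rfl

lemma IsTypeA.reflection_eq (hA : IsTypeA r R b) (i : ι) (x : V) :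
    R.reflection i x = x - inner ℝ x (R.root i) • R.root i := by
  rw [R.reflection_apply, ← hA.coroot_eq_root i, ← hA.pairing_eq_inner]
  rfl

lemma IsTypeA.isCrystallographic (hA : IsTypeA r R b) : R.IsCrystallographic := by
  obtain ⟨e, he⟩ := hA.cartan
  have hsimple (i j) (hi : i ∈ b.support) (hj : j ∈ b.support) :
      ∃ n : ℤ, (n : ℝ) = inner ℝ (R.root i) (R.root j) := by
    obtain ⟨i', hi'⟩ := e.surjective ⟨i, hi⟩
    obtain ⟨j', hj'⟩ := e.surjective ⟨j, hj⟩
    refine ⟨CartanMatrix.A r i' j', ?_⟩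
    rw [← hA.pairing_eq, ← he i' j', hi', hj']
  -- the roots lie in the `ℤ`-span of the simple roots
  have hspan {x : V} {P : V → Prop} (hx : ∃ j, x = R.root j)
      (h : ∀ j ∈ b.support, P (R.root j)) (h0 : P 0) (hadd : ∀ x y, P x → P y → P (x + y))
      (hneg : ∀ x, P x → P (-x)) : P x := by
    have hmem : ∀ y ∈ AddSubmonoid.closure (R.root '' b.support), P y := fun y hy => by
      induction hy using AddSubmonoid.closure_induction with
      | mem y hy => obtain ⟨j, hj, rfl⟩ := hy; exact h j hj
      | zero => exact h0
      | add y z _ _ h1 h2 => exact hadd y z h1 h2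
    obtain ⟨j, rfl⟩ := hx
    rcases b.root_mem_or_neg_mem j with hj | hj
    · exact hmem _ hj
    · rw [← neg_neg (R.root j)]
      exact hneg _ (hmem _ hj)
  refine ⟨fun i j => ?_⟩
  simp only [algebraMap_int_eq, eq_intCast, hA.pairing_eq]
  refine hspan (P := fun x => ∃ n : ℤ, (n : ℝ) = inner ℝ x (R.root j)) ⟨i, rfl⟩
    (fun k hk => ?_) ⟨0, by simp⟩ ?_ ?_
  · refine hspan (P := fun x => ∃ n : ℤ, (n : ℝ) = inner ℝ (R.root k) x) ⟨j, rfl⟩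
      (fun l hl => hsimple k l hk hl) ⟨0, by simp⟩ ?_ ?_
    · rintro x y ⟨m, hm⟩ ⟨n, hn⟩
      exact ⟨m + n, by rw [inner_add_right, ← hm, ← hn]; push_cast; rfl⟩
    · rintro x ⟨m, hm⟩
      exact ⟨-m, by rw [inner_neg_right, ← hm]; push_cast; rfl⟩
  · rintro x y ⟨m, hm⟩ ⟨n, hn⟩
    exact ⟨m + n, by rw [inner_add_left, ← hm, ← hn]; push_cast; rfl⟩
  · rintro x ⟨m, hm⟩
    exact ⟨-m, by rw [inner_neg_left, ← hm]; push_cast; rfl⟩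

lemma IsTypeA.isReduced (hA : IsTypeA r R b) : R.IsReduced := by
  refine ⟨fun i j h => ?_⟩
  rw [LinearIndependent.pair_iff' (R.ne_zero i)] at h
  push Not at h
  obtain ⟨a, ha⟩ := h
  have hn := hA.norm_sq_root j
  rw [← ha, norm_smul, mul_pow, hA.norm_sq_root, Real.norm_eq_abs, sq_abs] at hn
  have : a ^ 2 = 1 := by linarith
  rcases mul_self_eq_one_iff.1 (by linarith [sq a] : a * a = 1) with rfl | rfl
  · left; rw [← ha, one_smul]
  · right; rw [← ha]; simp

/-- Standard coordinates on a root system of type `A_r`: vectors `ε_0, …, ε_r`, the projections to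
`V` of the standard basis of `ℝ^(r+1)`, such that the simple roots are the `ε_k - ε_{k+1}`. The
condition on inner products determines them. -/
structure StdCoordinates (r : ℕ) (R : RootPairing ι ℝ V V) (b : R.Base) where
  /-- The labelling of the simple roots. -/
  simple : Fin r ≃ b.support
  /-- The vectors `ε_i`. -/
  ε : Fin (r + 1) → V
  root_simple : ∀ k, R.root (simple k) = ε k.castSucc - ε k.succ
  inner_simple : ∀ i k, (inner ℝ (ε i) (R.root (simple k)) : ℝ) =
    (if i = k.castSucc then 1 else 0) - if i = k.succ then 1 else 0

lemma IsTypeA.nonempty_stdCoordinates [R.IsRootSystem] (hA : IsTypeA r R b) :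
    Nonempty (StdCoordinates r R b) := by
  obtain ⟨e, he⟩ := hA.cartan
  have hin (k l : Fin r) : (inner ℝ (R.root (e k)) (R.root (e l)) : ℝ) = CartanMatrix.A r k l := by
    rw [← hA.pairing_eq, he]
  -- the first fundamental weight
  obtain ⟨ω, hω⟩ : ∃ ω : V, ∀ k : Fin r,
      (inner ℝ ω (R.root (e k)) : ℝ) = if (k : ℕ) = 0 then 1 else 0 := by
    let f : V →ₗ[ℝ] ℝ := b.toWeightBasis.constr ℝ fun k =>
      if ((e.symm k : Fin r) : ℕ) = 0 then (1 : ℝ) else 0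
    refine ⟨R.toLinearMap.toPerfPair.symm f, fun k => ?_⟩
    rw [← hA.pairing_eq_inner, LinearMap.apply_symm_toPerfPair_self, ← b.toWeightBasis_apply]
    rw [Module.Basis.constr_basis, Equiv.symm_apply_apply]
  set a : ℕ → V := fun l => if h : l < r then R.root (e ⟨l, h⟩) else 0 with ha
  have haf (k : Fin r) : a k = R.root (e k) := by simp [ha]
  refine ⟨⟨e, fun i => ω - ∑ l ∈ Finset.range i, a l, fun k => ?_, fun i k => ?_⟩⟩
  · simp [Finset.sum_range_succ, haf]
  · suffices ∀ i : ℕ, i ≤ r → (inner ℝ (ω - ∑ l ∈ Finset.range i, a l) (R.root (e k)) : ℝ) =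
        (if i = (k : ℕ) then 1 else 0) - if i = (k : ℕ) + 1 then 1 else 0 by
      simpa [Fin.ext_iff] using this i (Nat.lt_succ_iff.1 i.2)
    intro i hi
    induction i with
    | zero => simp [hω, eq_comm]
    | succ i ih =>
      have hai : a i = R.root (e ⟨i, hi⟩) := haf ⟨i, hi⟩
      rw [Finset.sum_range_succ, ← sub_sub, inner_sub_left, ih (by omega), hai, hin]
      simp only [CartanMatrix.A, Matrix.of_apply, Fin.ext_iff]
      have hk := k.2
      split_ifs <;> first | omega | norm_num

namespace StdCoordinates

variable (c : StdCoordinates r R b)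

lemma inner_ε_sub (i j k : Fin (r + 1)) : (inner ℝ (c.ε i) (c.ε j - c.ε k) : ℝ) =
    (if i = j then 1 else 0) - if i = k then 1 else 0 := by
  have h (j : Fin (r + 1)) : (inner ℝ (c.ε i) (c.ε j) : ℝ) - (if i = j then 1 else 0) =
      (inner ℝ (c.ε i) (c.ε 0) : ℝ) - if i = 0 then 1 else 0 := by
    induction j using Fin.induction with
    | zero => rfl
    | succ j ih =>
      rw [← ih]
      have := c.inner_simple i j
      rw [c.root_simple, inner_sub_right] at this
      linarith
  rw [inner_sub_right]
  linarith [h j, h k]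

lemma ε_sub_injective {i j k l : Fin (r + 1)} (hij : i < j) (h : c.ε i - c.ε j = c.ε k - c.ε l) :
    i = k ∧ j = l := by
  have h1 := c.inner_ε_sub i k l
  have h2 := c.inner_ε_sub j k l
  rw [← h, inner_ε_sub] at h1 h2
  rw [if_pos rfl, if_neg hij.ne] at h1
  rw [if_pos rfl, if_neg hij.ne'] at h2
  constructor
  · by_contra hne
    rw [if_neg hne] at h1
    split_ifs at h1 <;> norm_num at h1
  · by_contra hne
    rw [if_neg hne] at h2
    split_ifs at h2 <;> norm_num at h2

/-- A vector is determined by its inner products with the simple roots. -/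
lemma ext_simple [R.IsRootSystem] {x y : V}
    (h : ∀ k, (inner ℝ (R.root (c.simple k)) x : ℝ) = inner ℝ (R.root (c.simple k)) y) :
    x = y := by
  have hlin : (innerₗ V).flip x = (innerₗ V).flip y := b.toWeightBasis.ext fun i => by
    obtain ⟨k, rfl⟩ := c.simple.surjective i
    rw [b.toWeightBasis_apply]
    exact h k
  exact ext_inner_left ℝ fun v => LinearMap.congr_fun hlin v

lemma ext_ε [R.IsRootSystem] {x y : V}
    (h : ∀ i, (inner ℝ (c.ε i) x : ℝ) = inner ℝ (c.ε i) y) : x = y := by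
  refine c.ext_simple fun k => ?_
  rw [c.root_simple, inner_sub_left, inner_sub_left, h, h]

lemma reflection_ε_sub (hA : IsTypeA r R b) {i : ι} {j k : Fin (r + 1)}
    (hi : R.root i = c.ε j - c.ε k) (hjk : j ≠ k) (l : Fin (r + 1)) :
    R.reflection i (c.ε l) = c.ε (Equiv.swap j k l) := by
  rw [hA.reflection_eq, hi, c.inner_ε_sub]
  by_cases h1 : l = j
  · subst h1; simp [hjk]
  · by_cases h2 : l = k
    · subst h2; simp [hjk.symm]
    · simp [h1, h2, Equiv.swap_apply_of_ne_of_ne]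

lemma inner_reflection (hA : IsTypeA r R b) (i : ι) (x y : V) :
    (inner ℝ x (R.reflection i y) : ℝ) = inner ℝ (R.reflection i x) y := by
  rw [hA.reflection_eq, hA.reflection_eq, inner_sub_left, inner_sub_right, inner_smul_left,
    inner_smul_right, real_inner_comm (R.root i) y]
  simp [mul_comm]

/-- The `ε_i - ε_j`, `i < j`, are positive roots. -/
lemma exists_isPos_root_eq {i j : Fin (r + 1)} (hij : i < j) (hA : IsTypeA r R b) :
    ∃ a, b.IsPos a ∧ R.root a = c.ε i - c.ε j := by
  induction j using Fin.induction with
  | zero => simp at hij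
  | succ j ih =>
    have hs : b.IsPos (c.simple j : ι) := RootPairing.Base.isPos_of_mem_support (c.simple j).2
    rcases (Fin.le_castSucc_iff.2 hij).eq_or_lt with rfl | hlt
    · exact ⟨c.simple j, hs, c.root_simple j⟩
    · obtain ⟨a, ha, hroot⟩ := ih hlt
      have hr : R.root (R.reflectionPerm (c.simple j) a) = R.root a + R.root (c.simple j) := by
        rw [R.root_reflectionPerm, hroot, map_sub,
          c.reflection_ε_sub hA (c.root_simple j) (Fin.castSucc_lt_succ).ne,
          c.reflection_ε_sub hA (c.root_simple j) (Fin.castSucc_lt_succ).ne,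
          Equiv.swap_apply_left, Equiv.swap_apply_of_ne_of_ne hlt.ne hij.ne, c.root_simple]
        abel
      refine ⟨_, ha.add hs hr, ?_⟩
      rw [hr, hroot, c.root_simple]
      abel

lemma exists_root_eq [Finite ι] [R.IsRootSystem] (hA : IsTypeA r R b) (i : ι) :
    ∃ j k, j ≠ k ∧ R.root i = c.ε j - c.ε k := by
  have := hA.isCrystallographic
  have := hA.isReduced
  have hsimple : ∀ i ∈ b.support, ∃ k, i = c.simple k := fun i hi => by
    obtain ⟨k, hk⟩ := c.simple.surjective ⟨i, hi⟩
    exact ⟨k, by rw [hk]⟩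
  refine b.induction_reflect i (p := fun i => ∃ j k, j ≠ k ∧ R.root i = c.ε j - c.ε k) ?_ ?_ ?_
  · rintro i ⟨j, k, hjk, h⟩
    refine ⟨k, j, hjk.symm, ?_⟩
    rw [R.root_reflectionPerm, R.reflection_apply_self, h, neg_sub]
  · intro i hi
    obtain ⟨k, rfl⟩ := hsimple i hi
    exact ⟨_, _, (Fin.castSucc_lt_succ).ne, c.root_simple k⟩
  · rintro i l ⟨j, k, hjk, h⟩ hl
    obtain ⟨s, rfl⟩ := hsimple l hl
    refine ⟨_, _, (Equiv.swap s.castSucc s.succ).injective.ne hjk, ?_⟩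
    rw [R.root_reflectionPerm, h, map_sub,
      c.reflection_ε_sub hA (c.root_simple s) (Fin.castSucc_lt_succ).ne,
      c.reflection_ε_sub hA (c.root_simple s) (Fin.castSucc_lt_succ).ne]

lemma exists_root_eq_of_isPos [Finite ι] [R.IsRootSystem] (hA : IsTypeA r R b) {i : ι}
    (hi : b.IsPos i) : ∃ j k, j < k ∧ R.root i = c.ε j - c.ε k := by
  obtain ⟨j, k, hjk, h⟩ := c.exists_root_eq hA i
  rcases hjk.lt_or_gt with hlt | hlt
  · exact ⟨j, k, hlt, h⟩
  · exfalso
    obtain ⟨a, ha, hroot⟩ := c.exists_isPos_root_eq hlt hA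
    let := R.indexNeg
    have hai : a = -i := by
      apply R.root.injective
      have hneg : R.root (-i) = -R.root i := by simp
      rw [hroot, hneg, h, neg_sub]
    rw [hai, RootPairing.Base.IsPos.neg_iff_not] at ha
    exact ha hi

/-- Products over the positive roots as products over the pairs `i < j`. -/
lemma prod_posRoots [Fintype ι] [R.IsRootSystem] (hA : IsTypeA r R b) {M : Type*} [CommMonoid M]
    (f : V → M) :
    ∏ i ∈ posRoots b, f (R.root i) = ∏ p ∈ pairs (r + 1), f (c.ε p.1 - c.ε p.2) := by
  choose g hpos hroot using fun (p : Fin (r + 1) × Fin (r + 1)) (hp : p.1 < p.2) =>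
    c.exists_isPos_root_eq hp hA
  symm
  refine Finset.prod_bij (fun p hp => g p (mem_pairs.1 hp)) (fun p hp => ?_) (fun p hp p' hp' h => ?_)
    (fun i hi => ?_) fun p hp => ?_
  · simpa [posRoots] using hpos p (mem_pairs.1 hp)
  · have h' := hroot p (mem_pairs.1 hp)
    rw [h, hroot p' (mem_pairs.1 hp')] at h'
    obtain ⟨h1, h2⟩ := c.ε_sub_injective (mem_pairs.1 hp') h'
    exact Prod.ext h1.symm h2.symm
  · obtain ⟨j, k, hjk, h⟩ := c.exists_root_eq_of_isPos hA (i := i) (by simpa [posRoots] using hi)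
    refine ⟨(j, k), by simpa using hjk, R.root.injective ?_⟩
    rw [hroot (j, k) hjk, h]
  · rw [hroot p (mem_pairs.1 hp)]

/-- The Weyl group acts by permutations of the `ε_i`. -/
lemma exists_perm [Finite ι] [R.IsRootSystem] (hA : IsTypeA r R b) (w : R.weylGroup) :
    ∃ σ : Equiv.Perm (Fin (r + 1)), ∀ i x,
      (inner ℝ (c.ε i) (w • x) : ℝ) = inner ℝ (c.ε (σ i)) x := by
  obtain ⟨w, hw⟩ := w
  induction hw using RootPairing.weylGroup.induction with
  | mem a =>
    obtain ⟨j, k, hjk, h⟩ := c.exists_root_eq hA a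
    refine ⟨Equiv.swap j k, fun i x => ?_⟩
    rw [← c.reflection_ε_sub hA h hjk, ← inner_reflection hA]
    rfl
  | one => exact ⟨1, fun i x => by rw [Equiv.Perm.one_apply]; congr 1⟩
  | mul g₁ g₂ hg₁ hg₂ h₁ h₂ =>
    obtain ⟨σ, hσ⟩ := h₁
    obtain ⟨τ, hτ⟩ := h₂
    refine ⟨τ * σ, fun i x => ?_⟩
    rw [← Submonoid.mk_mul_mk _ _ _ hg₁ hg₂, mul_smul, hσ, hτ]
    rfl

lemma exists_weylGroup (hA : IsTypeA r R b) (σ : Equiv.Perm (Fin (r + 1))) :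
    ∃ w : R.weylGroup, ∀ i x, (inner ℝ (c.ε i) (w • x) : ℝ) = inner ℝ (c.ε (σ i)) x := by
  have hσ : σ ∈ Submonoid.closure
      (Set.range fun i : Fin r ↦ Equiv.swap i.castSucc i.succ) := by
    rw [Equiv.Perm.mclosure_swap_castSucc_succ]; trivial
  induction hσ using Submonoid.closure_induction with
  | mem σ h =>
    obtain ⟨k, rfl⟩ := h
    refine ⟨RootPairing.weylGroup.ofIdx R (c.simple k), fun i x => ?_⟩
    rw [← c.reflection_ε_sub hA (c.root_simple k) (Fin.castSucc_lt_succ).ne,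
      ← inner_reflection hA]
    rfl
  | one => exact ⟨1, fun i x => by rw [one_smul]; rfl⟩
  | mul σ τ _ _ h₁ h₂ =>
    obtain ⟨w₁, h₁⟩ := h₁
    obtain ⟨w₂, h₂⟩ := h₂
    refine ⟨w₂ * w₁, fun i x => ?_⟩
    rw [mul_smul, h₂, h₁]
    rfl

/-- Sums over the Weyl group as sums over the symmetric group. -/
lemma exists_weylGroup_equiv [Finite ι] [R.IsRootSystem] (hA : IsTypeA r R b) :
    ∃ e : R.weylGroup ≃ Equiv.Perm (Fin (r + 1)), ∀ w i x,
      (inner ℝ (c.ε i) (w • x) : ℝ) = inner ℝ (c.ε (e w i)) x := by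
  choose f hf using c.exists_perm hA
  refine ⟨Equiv.ofBijective f ⟨fun w w' h => ?_, fun σ => ?_⟩, hf⟩
  · apply Subtype.ext
    apply RootPairing.Equiv.weightHom_injective R
    ext x
    refine c.ext_ε fun i => ?_
    exact (hf w i x).trans ((congrArg (fun σ => (inner ℝ (c.ε (σ i)) x : ℝ)) h).trans
      (hf w' i x).symm)
  · obtain ⟨w, hw⟩ := c.exists_weylGroup hA σ
    refine ⟨w, Equiv.ext fun i => ?_⟩
    by_contra hne
    have h := (hf w i (c.ε (σ i) - c.ε (f w i))).symm.trans (hw i _)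
    rw [c.inner_ε_sub, c.inner_ε_sub, if_neg hne, if_pos rfl, if_pos rfl,
      if_neg (Ne.symm hne)] at h
    norm_num at h

end StdCoordinates

end Coordinates

/-! ### The spherical function in standard coordinates -/

section Spherical

variable {ι V : Type*} [NormedAddCommGroup V] [InnerProductSpace ℝ V]
  {r : ℕ} {R : RootPairing ι ℝ V V} {b : R.Base}

lemma cpair_sub (v w : V) (z : V × V) : cpair (v - w) z = cpair v z - cpair w z := by
  simp only [cpair, inner_sub_left]; push_cast; ring

lemma qTranslation_rpow_pos [Fintype ι] {q : ℕ} (hq : 2 ≤ q) (b : R.Base) (l : V) (s : ℝ) :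
    0 < qTranslation q b l ^ s :=
  Real.rpow_pos_of_pos (Real.rpow_pos_of_pos (by positivity) _) _

lemma weylPoincare_pos [Fintype ι] [R.IsRootSystem] {q : ℕ} (hq : 2 ≤ q) (b : R.Base) :
    0 < weylPoincare q b :=
  letI : Fintype R.weylGroup := Fintype.ofFinite _
  Finset.sum_pos (fun w _ => by positivity) ⟨1, Finset.mem_univ _⟩

namespace StdCoordinates

variable (c : StdCoordinates r R b)

/-- The exponentials `e^{⟨ε_i, z⟩}`. -/
def expCoord (z : V × V) (i : Fin (r + 1)) : ℂ := Complex.exp (cpair (c.ε i) z)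

lemma exp_neg_cpair_sub (z : V × V) (i j : Fin (r + 1)) :
    Complex.exp (-cpair (c.ε i - c.ε j) z) = c.expCoord z j / c.expCoord z i := by
  rw [cpair_sub, neg_sub, Complex.exp_sub]; rfl

lemma expCoord_ne_zero (z : V × V) (i : Fin (r + 1)) : c.expCoord z i ≠ 0 := Complex.exp_ne_zero _

/-- In standard coordinates `P_λ` is a normalized Hall–Littlewood polynomial. -/
lemma macdonaldSum_eq [Fintype ι] [R.IsRootSystem] (hA : IsTypeA r R b) (q : ℕ) (l : V)
    (m : Fin (r + 1) → ℕ) (hl : l = ∑ i, (m i : ℝ) • c.ε i) (z : V × V) :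
    macdonaldSum q b l z =
      ((qTranslation q b l ^ (-(1 / 2) : ℝ) / weylPoincare q b : ℝ) : ℂ) *
        hallLittlewood (((q : ℝ)⁻¹ : ℝ) : ℂ) m (c.expCoord z) := by
  let : Fintype R.weylGroup := Fintype.ofFinite _
  obtain ⟨e, he⟩ := c.exists_weylGroup_equiv hA
  have hexp (w : R.weylGroup) (i) : c.expCoord (w • z) i = c.expCoord z (e w i) := by
    simp only [expCoord, cpair, Prod.smul_fst, Prod.smul_snd, he]
  rw [macdonaldSum, hallLittlewood, symmetrize]
  congr 1
  rw [← e.sum_comp]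
  refine Finset.sum_congr rfl fun w _ => ?_
  rw [mul_comm]
  congr 1
  · have : cpair l (w • z) = ∑ i, (m i : ℂ) * cpair (c.ε i) (w • z) := by
      rw [hl]
      simp only [cpair, sum_inner, inner_smul_left]
      push_cast
      rw [Finset.sum_mul, ← Finset.sum_add_distrib]
      refine Finset.sum_congr rfl fun i _ => ?_
      simp
      ring
    rw [this, Complex.exp_sum]
    refine Finset.prod_congr rfl fun i _ => ?_
    rw [Complex.exp_nat_mul, Function.comp_apply, ← hexp]
    rfl
  · rw [kernel, ← prod_pairs fun i j => ((c.expCoord z ∘ e w) i - ((q : ℝ)⁻¹ : ℝ) *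
      (c.expCoord z ∘ e w) j) / ((c.expCoord z ∘ e w) i - (c.expCoord z ∘ e w) j), cFun]
    simp only [hA.coroot_eq_root]
    rw [c.prod_posRoots hA fun v => (1 - (q : ℂ)⁻¹ * Complex.exp (-cpair v (w • z))) /
      (1 - Complex.exp (-cpair v (w • z)))]
    refine Finset.prod_congr rfl fun p _ => ?_
    simp only [exp_neg_cpair_sub, hexp, Function.comp_apply]
    have h0 := c.expCoord_ne_zero z (e w p.1)
    generalize c.expCoord z (e w p.1) = x at *
    generalize c.expCoord z (e w p.2) = y at *
    have e1 : x - (((q : ℝ)⁻¹ : ℝ) : ℂ) * y = x * (1 - (q : ℂ)⁻¹ * (y / x)) := by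
      push_cast; field_simp
    have e2 : x - y = x * (1 - y / x) := by field_simp
    rw [e1, e2, mul_div_mul_left _ _ h0]

lemma expCoord_injective (hA : IsTypeA r R b) {z : V × V}
    (hz : z ∈ regularPoints R) : Function.Injective (c.expCoord z) := by
  have key {i j : Fin (r + 1)} (hij : i < j) : c.expCoord z i ≠ c.expCoord z j := fun h => by
    obtain ⟨a, -, ha⟩ := c.exists_isPos_root_eq hij hA
    apply hz a
    rw [hA.coroot_eq_root, ha, exp_neg_cpair_sub, h, div_self (c.expCoord_ne_zero z j)]
  intro i j h
  by_contra hne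
  rcases lt_or_gt_of_ne hne with hlt | hlt
  · exact key hlt h
  · exact key hlt h.symm

lemma tendsto_expCoord (hA : IsTypeA r R b) :
    Filter.Tendsto c.expCoord (𝓝[regularPoints R] 0) (𝓝[distinctPoints (r + 1)] 1) := by
  refine tendsto_nhdsWithin_iff.2 ⟨?_, ?_⟩
  · refine Filter.Tendsto.mono_left ?_ nhdsWithin_le_nhds
    have : Continuous c.expCoord := by
      unfold expCoord cpair
      fun_prop
    refine this.tendsto' _ _ ?_
    ext i
    simp [expCoord, cpair]
  · filter_upwards [self_mem_nhdsWithin] with z hz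
    exact c.expCoord_injective hA hz

/-- The regular points accumulate at `0`, along a direction off all the walls. -/
lemma zero_mem_closure_regularPoints (c : StdCoordinates r R b) [Finite ι]
    [R.IsRootSystem] (hA : IsTypeA r R b) :
    (0 : V × V) ∈ closure (regularPoints R) := by
  set v : V := ∑ i : Fin (r + 1), ((i : ℕ) : ℝ) • c.ε i
  have hv (i : ι) : (inner ℝ (R.root i) v : ℝ) ≠ 0 := by
    obtain ⟨j, k, hjk, h⟩ := c.exists_root_eq hA i
    have : (inner ℝ (R.root i) v : ℝ) = (j : ℕ) - (k : ℕ) := by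
      rw [h, real_inner_comm]
      simp only [v, sum_inner, inner_smul_left, c.inner_ε_sub]
      simp [mul_sub, Finset.sum_sub_distrib]
    rw [this, sub_ne_zero]
    exact_mod_cast Fin.val_ne_of_ne hjk
  have ht : Filter.Tendsto (fun s : ℝ => (s • v, (0 : V))) (𝓝[>] 0) (𝓝 (0 : V × V)) := by
    have : Continuous fun s : ℝ => (s • v, (0 : V)) := by fun_prop
    exact (this.tendsto' 0 0 (by simp)).mono_left nhdsWithin_le_nhds
  refine mem_closure_of_tendsto ht ?_
  filter_upwards [self_mem_nhdsWithin] with s hs i h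
  have hs0 : s ≠ 0 := ne_of_gt hs
  rw [hA.coroot_eq_root] at h
  simp only [cpair, inner_zero_right, Complex.ofReal_zero, zero_mul, add_zero,
    inner_smul_right] at h
  have h' : Real.exp (-(s * inner ℝ (R.root i) v)) = 1 := by exact_mod_cast h
  rw [Real.exp_eq_one_iff, neg_eq_zero] at h'
  exact mul_ne_zero hs0 (hv i) h'

/-- Dominant weights are the `∑ m_i ε_i` with `m` a decreasing tuple. -/
lemma exists_exponent [Fintype ι] [R.IsRootSystem] (hA : IsTypeA r R b) {l : V}
    (hl : l ∈ dominantWeights b) :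
    ∃ m : Fin (r + 1) → ℕ, Antitone m ∧ l = ∑ i, (m i : ℝ) • c.ε i := by
  have hnat (k : Fin r) : ∃ a : ℕ, (inner ℝ (R.root (c.simple k)) l : ℝ) = a := by
    obtain ⟨n, hn⟩ := hl.1 (c.simple k)
    rw [hA.coroot_eq_root] at hn
    have hpos : 0 ≤ (inner ℝ (R.root (c.simple k)) l : ℝ) := hl.2 _ (by
      simpa [posRoots] using RootPairing.Base.isPos_of_mem_support (c.simple k).2)
    rw [hn] at hpos
    lift n to ℕ using by exact_mod_cast hpos
    exact ⟨n, by simpa using hn⟩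
  choose a ha using hnat
  set A : ℕ → ℕ := fun i => if h : i < r then a ⟨i, h⟩ else 0 with hAdef
  refine ⟨fun i => ∑ k ∈ Finset.Ico (i : ℕ) r, A k, fun i j hij =>
    Finset.sum_le_sum_of_subset (Finset.Ico_subset_Ico_left hij), c.ext_simple fun k => ?_⟩
  have hAk : A k = a k := by simp [hAdef]
  rw [ha, real_inner_comm]
  simp only [sum_inner, inner_smul_left, c.inner_simple]
  simp only [mul_sub, Finset.sum_sub_distrib]
  simp [Finset.sum_eq_sum_Ico_succ_bot k.2, hAk]

lemma inner_ε_sub_eq {m : Fin (r + 1) → ℕ} {l : V} (hl : l = ∑ i, (m i : ℝ) • c.ε i)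
    (j k : Fin (r + 1)) : (inner ℝ (c.ε j - c.ε k) l : ℝ) = m j - m k := by
  rw [hl, real_inner_comm]
  simp only [sum_inner, inner_smul_left, c.inner_ε_sub]
  simp [mul_sub, Finset.sum_sub_distrib]

lemma prod_posRoots_inner [Fintype ι] [R.IsRootSystem] (hA : IsTypeA r R b) {m : Fin (r + 1) → ℕ} {l : V}
    (hl : l = ∑ i, (m i : ℝ) • c.ε i) (f : ℝ → ℝ) :
    ∏ i ∈ posRoots b, f (inner ℝ (R.coroot i) l) = ∏ p ∈ pairs (r + 1), f (m p.1 - m p.2) := by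
  simp only [hA.coroot_eq_root]
  rw [c.prod_posRoots hA fun v => f (inner ℝ v l)]
  exact Finset.prod_congr rfl fun p _ => by rw [c.inner_ε_sub_eq hl]

/-- The singularities of `P_λ` at `0` cancel, and `F₀(λ)` is a normalized value at `(1, …, 1)` of a
Hall–Littlewood polynomial. -/
lemma tendsto_macdonaldSum [Fintype ι] [R.IsRootSystem] (hA : IsTypeA r R b) {q : ℕ} (hq : 2 ≤ q) {l : V}
    {m : Fin (r + 1) → ℕ} (hm : Antitone m) (hl : l = ∑ i, (m i : ℝ) • c.ε i) :
    Filter.Tendsto (macdonaldSum q b l) (𝓝[regularPoints R] 0)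
      (𝓝 ((qTranslation q b l ^ (-(1 / 2) : ℝ) / weylPoincare q b *
        valueAtOne (q : ℝ)⁻¹ m : ℝ) : ℂ)) := by
  have h1 : (q : ℝ)⁻¹ ≤ 1 := inv_le_one_of_one_le₀ (by exact_mod_cast (by omega : 1 ≤ q))
  have h := ((tendsto_hallLittlewood (by positivity) h1 hm).comp (c.tendsto_expCoord hA)).const_mul
    ((qTranslation q b l ^ (-(1 / 2) : ℝ) / weylPoincare q b : ℝ) : ℂ)
  rw [Complex.ofReal_mul]
  exact h.congr fun z => (c.macdonaldSum_eq hA q l m hl z).symm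

lemma F₀_eq [Fintype ι] [R.IsRootSystem] (hA : IsTypeA r R b) {q : ℕ} (hq : 2 ≤ q) {l : V}
    {m : Fin (r + 1) → ℕ} (hm : Antitone m) (hl : l = ∑ i, (m i : ℝ) • c.ε i) :
    F₀ q b l = ((qTranslation q b l ^ (-(1 / 2) : ℝ) / weylPoincare q b *
        valueAtOne (q : ℝ)⁻¹ m : ℝ) : ℂ) :=
  extendFrom_eq (c.zero_mem_closure_regularPoints hA) (c.tendsto_macdonaldSum hA hq hm hl)

end StdCoordinates

end Spherical

end MacdonaldSpherical

end

open MacdonaldSpherical in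
theorem proposition2p1 {ι V : Type*} [Fintype ι] [NormedAddCommGroup V] [InnerProductSpace ℝ V]
    (r : ℕ) (hr : 1 ≤ r) (R : RootPairing ι ℝ V V) [R.IsRootSystem] (b : R.Base)
    (hA : IsTypeA r R b) (q : ℕ) (hq : 2 ≤ q) :
    -- `F₀(λ) = P_λ(0)` is well defined (the singularities at `0` cancel) and real
    (∀ l ∈ dominantWeights b,
      Filter.Tendsto (macdonaldSum q b l) (𝓝[regularPoints R] 0) (𝓝 (F₀ q b l)) ∧
        (F₀ q b l).im = 0) ∧
    -- the global estimate on `P⁺`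
    (∃ C : ℝ, 0 < C ∧ ∀ l ∈ dominantWeights b,
      C⁻¹ * (qTranslation q b l ^ (-(1 / 2) : ℝ) *
          ∏ i ∈ posRoots b, (1 + inner ℝ (R.coroot i) l)) ≤ (F₀ q b l).re ∧
        (F₀ q b l).re ≤ C * (qTranslation q b l ^ (-(1 / 2) : ℝ) *
          ∏ i ∈ posRoots b, (1 + inner ℝ (R.coroot i) l))) ∧
    -- the asymptotics away from the walls
    (∃ c : ℝ, 0 < c ∧
      Filter.Tendsto
        (fun l => (F₀ q b l).re / (c * piFun b l * qTranslation q b l ^ (-(1 / 2) : ℝ)))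
        (awayFromWalls b) (𝓝 1)) := by
  obtain ⟨c⟩ := hA.nonempty_stdCoordinates
  have h0 : 0 ≤ (q : ℝ)⁻¹ := by positivity
  have h1 : (q : ℝ)⁻¹ < 1 := inv_lt_one_of_one_lt₀ (by exact_mod_cast (by omega : 1 < q))
  have hW := weylPoincare_pos hq b
  choose! m hm hl using fun (l : V) (h : l ∈ dominantWeights b) => c.exists_exponent hA h
  have hF (l : V) (h : l ∈ dominantWeights b) := c.F₀_eq hA hq (hm l h) (hl l h)
  refine ⟨fun l h => ⟨?_, ?_⟩, ?_, ?_⟩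
  · rw [hF l h]
    exact c.tendsto_macdonaldSum hA hq (hm l h) (hl l h)
  · rw [hF l h, Complex.ofReal_im]
  · obtain ⟨a, ha, hlow⟩ := HallLittlewood.exists_lower_bound (r + 1) h0 h1
    obtain ⟨A, hA', hup⟩ := HallLittlewood.exists_upper_bound (r + 1) (q : ℝ)⁻¹
    have hmax : 0 < max (weylPoincare q b / a) (A / weylPoincare q b) :=
      lt_max_of_lt_left (div_pos hW ha)
    refine ⟨_, hmax, fun l h => ?_⟩
    have hQ := qTranslation_rpow_pos hq b l (-(1 / 2))
    have hlo := hlow _ (hm l h)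
    have hhi := hup _ (hm l h)
    rw [hF l h, Complex.ofReal_re, c.prod_posRoots_inner hA (hl l h) fun x => 1 + x]
    have hP : 0 ≤ ∏ p ∈ HallLittlewood.pairs (r + 1), (1 + ((m l p.1 : ℝ) - m l p.2)) :=
      Finset.prod_nonneg fun p hp => by
        have : (m l p.2 : ℝ) ≤ m l p.1 := by
          exact_mod_cast hm l h (HallLittlewood.mem_pairs.1 hp).le
        linarith
    set Q := qTranslation q b l ^ (-(1 / 2) : ℝ)
    set P := ∏ p ∈ HallLittlewood.pairs (r + 1), (1 + ((m l p.1 : ℝ) - m l p.2))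
    constructor
    · calc _ ≤ (weylPoincare q b / a)⁻¹ * (Q * P) := by
            refine mul_le_mul_of_nonneg_right ?_ (mul_nonneg hQ.le hP)
            exact inv_anti₀ (div_pos hW ha) (le_max_left _ _)
        _ = Q / weylPoincare q b * (a * P) := by rw [inv_div]; ring
        _ ≤ _ := mul_le_mul_of_nonneg_left hlo (div_pos hQ hW).le
    · calc _ ≤ Q / weylPoincare q b * (A * P) :=
            mul_le_mul_of_nonneg_left hhi (div_pos hQ hW).le
        _ = A / weylPoincare q b * (Q * P) := by ring
        _ ≤ _ := mul_le_mul_of_nonneg_right (le_max_right _ _) (mul_nonneg hQ.le hP)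
  · have hlead := HallLittlewood.leadingCoeff_pos (r + 1) h1
    refine ⟨HallLittlewood.leadingCoeff (r + 1) (q : ℝ)⁻¹ / weylPoincare q b,
      div_pos hlead hW, ?_⟩
    have hdom : ∀ᶠ l in awayFromWalls b, l ∈ dominantWeights b :=
      Filter.mem_inf_of_right (Filter.mem_principal_self _)
    have htop : ∀ p ∈ HallLittlewood.pairs (r + 1),
        Filter.Tendsto (fun l => (m l p.1 : ℝ) - m l p.2) (awayFromWalls b) Filter.atTop := by
      intro p hp
      obtain ⟨i, hi, hroot⟩ := c.exists_isPos_root_eq (HallLittlewood.mem_pairs.1 hp) hA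
      have : Filter.Tendsto (fun l : V => (inner ℝ (R.root i) l : ℝ)) (awayFromWalls b)
          Filter.atTop :=
        Filter.tendsto_comap.mono_left
          (inf_le_left.trans (iInf₂_le i (by simpa [posRoots] using hi)))
      refine this.congr' ?_
      filter_upwards [hdom] with l h
      rw [hroot, c.inner_ε_sub_eq (hl l h)]
    have hlim := (HallLittlewood.tendsto_valueAtOne_div (q : ℝ)⁻¹ htop).div_const
      (HallLittlewood.leadingCoeff (r + 1) (q : ℝ)⁻¹)
    rw [div_self hlead.ne'] at hlim
    refine hlim.congr' ?_
    filter_upwards [hdom] with l h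
    have hQ := qTranslation_rpow_pos hq b l (-(1 / 2))
    rw [hF l h, Complex.ofReal_re, piFun, c.prod_posRoots_inner hA (hl l h) fun x => x]
    set Q := qTranslation q b l ^ (-(1 / 2) : ℝ)
    rw [div_div, ← mul_div_mul_left _ _ (div_pos hQ hW).ne']
    congr 1
    ring
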